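/- **Proposition ($E_q(2)$ as a crossed product).** Let $k$ be a field, let $q,\mu,\nu\in k^*$ and $s\in\mathbb Z$. Let $P=E_q(2)$ be the unital associative $k$-algebra generated by $v,v^{-1},n,\bar n$ subject to $$vn=q^2nv,\quad v\bar n=q^2\bar nv,\quad n\bar n=q^2\bar nn,\quad vv^{-1}=v^{-1}v=1,$$ let $X_q$ (the quantum hyperboloid) be the unital associative $k$-algebra generated by $z,\bar z$ subject to $z\bar z=q^2\bar zz+(1-q^2)$, and let $C$ be the coalgebra with basis $c_p$, $p\in\mathbb Z$, of group-like elements ($\Delta c_p=c_p\otimes c_p$, $\epsilon(c_p)=1$). *Terminology.* An entwining structure is a linear map $\psi:C\otimes P\to P\otimes C$, written $\psi(c\otimes u)=u_\alpha\otimes c^\alpha$, such that (A) $\psi\circ(\mathrm{id}_C\otimes\mathrm{mult})=(\mathrm{mult}\otimes\mathrm{id}_C)\circ(\mathrm{id}_P\otimes\psi)\circ(\psi\otimes\mathrm{id}_P)$ and $\psi(c\otimes1)=1\otimes c$; (B) $(\mathrm{id}_P\otimes\Delta)\circ\psi=(\psi\otimes\mathrm{id}_C)\circ(\mathrm{id}_C\otimes\psi)\circ(\Delta\otimes\mathrm{id}_P)$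 and $(\mathrm{id}_P\otimes\epsilon)\circ\psi=\epsilon\otimes\mathrm{id}_P$. Entwining data $(P,C,\psi,e,\psi^C)$ consist of an entwining structure $\psi$, a group-like $e\in C$, and a linear map $\psi^C:C\otimes C\to C\otimes C$, written $\psi^C(b\otimes c)=c_A\otimes b^A$, satisfying the conditions (B) with $P$ replaced by $C$, and $\psi^C(e\otimes c)=\Delta c$. Put $M=\{x\in P:\psi(e\otimes x)=x\otimes e\}$, a subalgebra of $P$. Crossed product data are linear maps $\rho:C\otimes P\to P$ and $\sigma:C\otimes C\to M$ such that for all $a,b,c\in C$ and $x,y\in M$ (i) $\rho(e,x)=x$, $\rho(c,1)=\epsilon(c)$; (ii) $\rho(c_{(1)},x_\alpha)\otimes c_{(2)}{}^\alpha\in M\otimes C$; (iii) $\rho(c_{(1)},(xy)_\alpha)\otimes c_{(2)}{}^\alpha=\rho(c_{(1)},x_\alpha)\,\rho(c_{(2)}{}^\alpha{}_{(1)},y_\beta)\otimes c_{(2)}{}^\alpha{}_{(2)}{}^\beta$; (iv) $\sigma(e,c)=\epsilon(c)$, $\sigma(c_{(1)},e_A)\otimes c_{(2)}{}^A=1\otimes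 c$; (v) $\rho(a_{(1)},\sigma(b_{(1)},c_A)_\alpha)\,\sigma(a_{(2)}{}^\alpha{}_{(1)},b_{(2)}{}^A{}_B)\otimes a_{(2)}{}^\alpha{}_{(2)}{}^B=\sigma(a_{(1)},b_A)\,\sigma(a_{(2)}{}^A{}_{(1)},c_B)\otimes a_{(2)}{}^A{}_{(2)}{}^B$; (vi) $\rho(a_{(1)},\rho(b_{(1)},x_\alpha)_\beta)\,\sigma(a_{(2)}{}^\beta{}_{(1)},b_{(2)}{}^\alpha{}_A)\otimes a_{(2)}{}^\beta{}_{(2)}{}^A=\sigma(a_{(1)},b_A)\,\rho(a_{(2)}{}^A{}_{(1)},x_\alpha)\otimes a_{(2)}{}^A{}_{(2)}{}^\alpha$. The crossed product $M\rtimes_{\rho,\sigma}C$ is then the vector space $M\otimes C$ with the associative product $$(x\otimes b)(y\otimes c)=x\,\rho(b_{(1)},y_\alpha)\,\sigma(b_{(2)}{}^\alpha{}_{(1)},c_A)\otimes b_{(2)}{}^\alpha{}_{(2)}{}^A$$ and the unit $1\otimes e$. *Claim.* 1. There is exactly one linear map $\psi:C\otimes P\to P\otimes C$ satisfying (A) and,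 for all $p\in\mathbb Z$, $$\psi(c_p\otimes v)=v\otimes c_{p+1},\qquad\psi(c_p\otimes n)=n\otimes c_p+\mu q^{2p}v\otimes c_p-\mu q^{2p}v\otimes c_{p+1},$$ $$\psi(c_p\otimes v^{-1})=v^{-1}\otimes c_{p-1},\qquad\psi(c_p\otimes\bar n)=\bar n\otimes c_p+\nu q^{2p}v^{-1}\otimes c_p-\nu q^{2p}v^{-1}\otimes c_{p-1}.$$ It also satisfies (B), and together with $e=c_s$ and $\psi^C(c_p\otimes c_r)=c_r\otimes c_{p+r-s}$ it gives entwining data. 2. There is an algebra isomorphism $X_q\cong M$ with $z\mapsto v+\mu^{-1}q^{-2s}n$ and $\bar z\mapsto v^{-1}+\nu^{-1}q^{-2s}\bar n$. 3. The linear map $\Phi:C\to P$, $\Phi(c_p)=v^{p-s}$, satisfies $\Phi(e)=1$, is invertible for the convolution product $(f*g)(c)=f(c_{(1)})g(c_{(2)})$, and is covariant: $\psi\circ(\mathrm{id}_C\otimes\Phi)=(\Phi\otimes\mathrm{id}_C)\circ\psi^C$. 4. The formulas $\rho(c,u)=\Phi(c_{(1)})u_\alpha\Phi^{-1}(c_{(2)}{}^\alpha)$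 and $\sigma(b,c)=\Phi(b_{(1)})\Phi(c_A)\Phi^{-1}(b_{(2)}{}^A)$, where $\Phi^{-1}$ is the convolution inverse, define crossed product data ($\sigma$ takes values in $M$). Here $\sigma(c_p,c_r)=1$ for all $p,r\in\mathbb Z$, and for all $p\in\mathbb Z$ $$\rho(c_p,v^{\pm1})=1,\quad\rho(c_p,n)=q^{2p}\bigl(q^{-2s}n+\mu(v-1)\bigr),\quad\rho(c_p,\bar n)=q^{2p}\bigl(q^{-2s}\bar n+\nu(v^{-1}-1)\bigr).$$ 5. Writing $X_q\rtimes_\Phi C$ for $M\rtimes_{\rho,\sigma}C$, with $M$ identified with $X_q$ by part 2, the map $x\otimes c\mapsto x\,\Phi(c)$ is an isomorphism of algebras $X_q\rtimes_\Phi C\cong E_q(2)$. -/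

import Mathlib

open scoped TensorProduct

noncomputable section

namespace CoalgCrossed

section General

variable {k : Type*} [Field k]
variable {C : Type*} [AddCommGroup C] [Module k C]
variable {P : Type*} [Ring P] [Algebra k P]
variable {Q : Type*} [AddCommGroup Q] [Module k Q]

/-- For `f : C ⊗ Q → P ⊗ C`, the map `(P ⊗ C) ⊗ Q → P ⊗ C`, `(p ⊗ c) ⊗ u ↦ p · f (c ⊗ u)`,
that is `(μ ⊗ id_C) ∘ (id_P ⊗ f)`. -/
def mulExt (f : C ⊗[k] Q →ₗ[k] P ⊗[k] C) : (P ⊗[k] C) ⊗[k] Q →ₗ[k] P ⊗[k] C :=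
  (LinearMap.mul' k P).rTensor C ∘ₗ (TensorProduct.assoc k P P C).symm.toLinearMap ∘ₗ
    f.lTensor P ∘ₗ (TensorProduct.assoc k P C Q).toLinearMap

/-- For `f : C ⊗ Q → P` and `φ : C ⊗ Q → Q ⊗ C`, `φ (c ⊗ u) = u_α ⊗ c^α`, the map
`C ⊗ Q → P ⊗ C`, `c ⊗ u ↦ f (c₁ ⊗ u_α) ⊗ c₂^α`. -/
def hat [Coalgebra k C] (φ : C ⊗[k] Q →ₗ[k] Q ⊗[k] C) (f : C ⊗[k] Q →ₗ[k] P) :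
    C ⊗[k] Q →ₗ[k] P ⊗[k] C :=
  f.rTensor C ∘ₗ (TensorProduct.assoc k C Q C).symm.toLinearMap ∘ₗ
    φ.lTensor C ∘ₗ (TensorProduct.assoc k C C Q).toLinearMap ∘ₗ
      (Coalgebra.comul (R := k) (A := C)).rTensor Q

/-- `ψ : C ⊗ P → P ⊗ C` is compatible with the algebra structure of `P`:
`ψ ∘ (id_C ⊗ μ) = (μ ⊗ id_C) ∘ ψ₂₃ ∘ ψ₁₂` and `ψ (c ⊗ 1) = 1 ⊗ c`. -/
structure CompatibleAlg (ψ : C ⊗[k] P →ₗ[k] P ⊗[k] C) : Prop where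
  mul : ψ ∘ₗ (LinearMap.mul' k P).lTensor C =
    mulExt ψ ∘ₗ ψ.rTensor P ∘ₗ (TensorProduct.assoc k C P P).symm.toLinearMap
  one : ∀ c : C, ψ (c ⊗ₜ 1) = 1 ⊗ₜ c

/-- `φ : C ⊗ Q → Q ⊗ C` is compatible with the coalgebra structure of `C`:
`(id_Q ⊗ Δ) ∘ φ = φ₁₂ ∘ φ₂₃ ∘ (Δ ⊗ id_Q)` and `(id_Q ⊗ ε) ∘ φ = ε ⊗ id_Q`. -/
structure CompatibleCoalg [Coalgebra k C] (φ : C ⊗[k] Q →ₗ[k] Q ⊗[k] C) : Prop where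
  comul : (Coalgebra.comul (R := k) (A := C)).lTensor Q ∘ₗ φ =
    (TensorProduct.assoc k Q C C).toLinearMap ∘ₗ φ.rTensor C ∘ₗ
      (TensorProduct.assoc k C Q C).symm.toLinearMap ∘ₗ φ.lTensor C ∘ₗ
        (TensorProduct.assoc k C C Q).toLinearMap ∘ₗ
          (Coalgebra.comul (R := k) (A := C)).rTensor Q
  counit : (TensorProduct.rid k Q).toLinearMap ∘ₗ
      (Coalgebra.counit (R := k) (A := C)).lTensor Q ∘ₗ φ =
    (TensorProduct.lid k Q).toLinearMap ∘ₗ (Coalgebra.counit (R := k) (A := C)).rTensor Q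

end General

/-- Entwining data `(P, C, ψ, e, ψ^C)`: an entwining structure `ψ` between the coalgebra `C` and
the algebra `P`, a group-like `e ∈ C`, and a map `ψ^C : C ⊗ C → C ⊗ C` compatible with the
coalgebra structure and satisfying `ψ^C (e ⊗ c) = Δ c`. -/
structure EntwiningData (k C P : Type*) [Field k] [AddCommGroup C] [Module k C] [Coalgebra k C]
    [Ring P] [Algebra k P] where
  ψ : C ⊗[k] P →ₗ[k] P ⊗[k] C
  ψ_alg : CompatibleAlg ψ
  ψ_coalg : CompatibleCoalg ψ
  e : C
  e_groupLike : IsGroupLikeElem k e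
  ψC : C ⊗[k] C →ₗ[k] C ⊗[k] C
  ψC_coalg : CompatibleCoalg ψC
  ψC_e : ∀ c : C, ψC (e ⊗ₜ c) = Coalgebra.comul (R := k) c

section Lemmas

variable {k : Type*} [Field k]
variable {C : Type*} [AddCommGroup C] [Module k C]
variable {P : Type*} [Ring P] [Algebra k P]
variable {Q : Type*} [AddCommGroup Q] [Module k Q]

theorem mulExt_tmul (f : C ⊗[k] Q →ₗ[k] P ⊗[k] C) (p : P) (c : C) (u : Q) :
    mulExt f ((p ⊗ₜ c) ⊗ₜ u) = p • f (c ⊗ₜ u) := by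
  simp only [mulExt, LinearMap.comp_apply, LinearEquiv.coe_coe, TensorProduct.assoc_tmul,
    LinearMap.lTensor_tmul]
  induction f (c ⊗ₜ[k] u) with
  | zero => simp
  | tmul a b => simp [TensorProduct.smul_tmul']
  | add a b ha hb => simp only [TensorProduct.tmul_add, map_add, smul_add, ha, hb]

theorem mulExt_smul (f : C ⊗[k] Q →ₗ[k] P ⊗[k] C) (p : P) (t : P ⊗[k] C) (u : Q) :
    mulExt f ((p • t) ⊗ₜ u) = p • mulExt f (t ⊗ₜ u) := by
  induction t with
  | zero => simp
  | tmul a b => simp [TensorProduct.smul_tmul', mulExt_tmul, mul_smul]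
  | add a b ha hb => simp only [smul_add, TensorProduct.add_tmul, map_add, ha, hb]

end Lemmas

namespace EntwiningData

variable {k C P : Type*} [Field k] [AddCommGroup C] [Module k C] [Coalgebra k C]
  [Ring P] [Algebra k P]

theorem ψ_mul (D : EntwiningData k C P) (c : C) (u w : P) :
    D.ψ (c ⊗ₜ (u * w)) = mulExt D.ψ (D.ψ (c ⊗ₜ u) ⊗ₜ w) := by
  simpa using LinearMap.congr_fun D.ψ_alg.mul (c ⊗ₜ[k] (u ⊗ₜ[k] w))

/-- The fixed point subalgebra `M = {x ∈ P | Δ_R x = x ⊗ e}`, where `Δ_R u = ψ (e ⊗ u)`. -/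
def M (D : EntwiningData k C P) : Subalgebra k P where
  carrier := {x | D.ψ (D.e ⊗ₜ x) = x ⊗ₜ D.e}
  mul_mem' := by
    intro a b ha hb
    simp only [Set.mem_ofPred_eq] at ha hb ⊢
    rw [ψ_mul, ha, mulExt_tmul, hb, TensorProduct.smul_tmul', smul_eq_mul]
  add_mem' := by
    intro a b ha hb
    simp only [Set.mem_ofPred_eq] at ha hb ⊢
    rw [TensorProduct.tmul_add, map_add, ha, hb, TensorProduct.add_tmul]
  algebraMap_mem' := by
    intro r
    simp only [Set.mem_ofPred_eq, Algebra.algebraMap_eq_smul_one]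
    rw [TensorProduct.tmul_smul, map_smul, D.ψ_alg.one, TensorProduct.smul_tmul']

/-- The inclusion `M ⊗ C → P ⊗ C`. -/
def incl (D : EntwiningData k C P) : D.M ⊗[k] C →ₗ[k] P ⊗[k] C :=
  D.M.val.toLinearMap.rTensor C

theorem incl_tmul (D : EntwiningData k C P) (x : D.M) (c : C) :
    D.incl (x ⊗ₜ c) = (x : P) ⊗ₜ c := rfl

theorem incl_injective (D : EntwiningData k C P) : Function.Injective D.incl :=
  Module.Flat.rTensor_preserves_injective_linearMap _ Subtype.val_injective

/-- `ρ̂ (c ⊗ u) = ρ (c₁, u_α) ⊗ c₂^α`. -/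
def rhoHat (D : EntwiningData k C P) (ρ : C ⊗[k] P →ₗ[k] P) : C ⊗[k] P →ₗ[k] P ⊗[k] C :=
  hat D.ψ ρ

/-- `σ̂ (b ⊗ c) = σ (b₁, c_A) ⊗ b₂^A`, with values in `M ⊗ C ⊆ P ⊗ C`. -/
def sigmaHat (D : EntwiningData k C P) (σ : C ⊗[k] C →ₗ[k] D.M) : C ⊗[k] C →ₗ[k] P ⊗[k] C :=
  hat D.ψC (D.M.val.toLinearMap ∘ₗ σ)

/-- The formula for the product,
`(x ⊗ b)(y ⊗ c) = x ρ (b₁, y_α) σ (b₂^α₁, c_A) ⊗ b₂^α₂^A`, on all of `P ⊗ C`. -/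
def mulFormula (D : EntwiningData k C P) (ρ : C ⊗[k] P →ₗ[k] P) (σ : C ⊗[k] C →ₗ[k] D.M) :
    (P ⊗[k] C) ⊗[k] (P ⊗[k] C) →ₗ[k] P ⊗[k] C :=
  mulExt (D.sigmaHat σ) ∘ₗ (mulExt (D.rhoHat ρ)).rTensor C ∘ₗ
    (TensorProduct.assoc k (P ⊗[k] C) P C).symm.toLinearMap

/-- `(ρ, σ)` are crossed product data for the given entwining data. -/
structure IsCrossedProductData (D : EntwiningData k C P) (ρ : C ⊗[k] P →ₗ[k] P)
    (σ : C ⊗[k] C →ₗ[k] D.M) : Prop where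
  /-- `ρ (e, x) = x` for `x ∈ M` -/
  rho_e : ∀ x ∈ D.M, ρ (D.e ⊗ₜ x) = x
  /-- `ρ (c, 1) = ε (c)` -/
  rho_one : ∀ c : C, ρ (c ⊗ₜ 1) = algebraMap k P (Coalgebra.counit (R := k) c)
  /-- `ρ (c₁, x_α) ⊗ c₂^α ∈ M ⊗ C` for `x ∈ M` -/
  rho_mem : ∀ (c : C), ∀ x ∈ D.M, D.rhoHat ρ (c ⊗ₜ x) ∈ LinearMap.range D.incl
  /-- `ρ (c₁, (xy)_α) ⊗ c₂^α = ρ (c₁, x_α) ρ (c₂^α₁, y_β) ⊗ c₂^α₂^β` for `x, y ∈ M` -/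
  rho_mul : ∀ (c : C), ∀ x ∈ D.M, ∀ y ∈ D.M,
    D.rhoHat ρ (c ⊗ₜ (x * y)) = mulExt (D.rhoHat ρ) (D.rhoHat ρ (c ⊗ₜ x) ⊗ₜ y)
  /-- `σ (e, c) = ε (c)` -/
  sigma_e : ∀ c : C, σ (D.e ⊗ₜ c) = algebraMap k D.M (Coalgebra.counit (R := k) c)
  /-- `σ (c₁, e_A) ⊗ c₂^A = 1 ⊗ c` -/
  sigma_hat_e : ∀ c : C, D.sigmaHat σ (c ⊗ₜ D.e) = 1 ⊗ₜ c
  /-- The cocycle condition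
  `ρ (a₁, σ (b₁, c_A)_α) σ (a₂^α₁, b₂^A_B) ⊗ a₂^α₂^B = σ (a₁, b_A) σ (a₂^A₁, c_B) ⊗ a₂^A₂^B`. -/
  cocycle : ∀ a b c : C,
    mulExt (D.sigmaHat σ) ((D.rhoHat ρ).rTensor C
        ((TensorProduct.assoc k C P C).symm (a ⊗ₜ D.sigmaHat σ (b ⊗ₜ c)))) =
      mulExt (D.sigmaHat σ) (D.sigmaHat σ (a ⊗ₜ b) ⊗ₜ c)
  /-- The twisted module condition
  `ρ (a₁, ρ (b₁, x_α)_β) σ (a₂^β₁, b₂^α_A) ⊗ a₂^β₂^A = σ (a₁, b_A) ρ (a₂^A₁, x_α) ⊗ a₂^A₂^α`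
  for `x ∈ M`. -/
  twisted_module : ∀ a b : C, ∀ x ∈ D.M,
    mulExt (D.sigmaHat σ) ((D.rhoHat ρ).rTensor C
        ((TensorProduct.assoc k C P C).symm (a ⊗ₜ D.rhoHat ρ (b ⊗ₜ x)))) =
      mulExt (D.rhoHat ρ) (D.sigmaHat σ (a ⊗ₜ b) ⊗ₜ x)

section Product

variable {D : EntwiningData k C P} {ρ : C ⊗[k] P →ₗ[k] P} {σ : C ⊗[k] C →ₗ[k] D.M}

theorem mulFormula_tmul (t : P ⊗[k] C) (w : P) (c : C) :
    D.mulFormula ρ σ (t ⊗ₜ (w ⊗ₜ c)) =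
      mulExt (D.sigmaHat σ) (mulExt (D.rhoHat ρ) (t ⊗ₜ w) ⊗ₜ c) := by
  simp [mulFormula]

theorem mulFormula_smul (p : P) (t s : P ⊗[k] C) :
    D.mulFormula ρ σ ((p • t) ⊗ₜ s) = p • D.mulFormula ρ σ (t ⊗ₜ s) := by
  induction s with
  | zero => simp
  | tmul a b => simp only [mulFormula_tmul, mulExt_smul]
  | add a b ha hb => simp only [smul_add, TensorProduct.tmul_add, map_add, ha, hb]

theorem mulFormula_one_tmul (a : C) (s : P ⊗[k] C) :
    D.mulFormula ρ σ ((1 ⊗ₜ a) ⊗ₜ s) =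
      mulExt (D.sigmaHat σ) ((D.rhoHat ρ).rTensor C
        ((TensorProduct.assoc k C P C).symm (a ⊗ₜ s))) := by
  induction s with
  | zero => simp
  | tmul x b => simp [mulFormula_tmul, mulExt_tmul]
  | add x b hx hb => simp only [TensorProduct.tmul_add, map_add, hx, hb]

theorem smul_mem_range {x : P} (hx : x ∈ D.M) {t : P ⊗[k] C}
    (ht : t ∈ LinearMap.range D.incl) : x • t ∈ LinearMap.range D.incl := by
  obtain ⟨w, rfl⟩ := ht
  induction w with
  | zero => simp
  | tmul a b =>
    refine ⟨(⟨x, hx⟩ * a) ⊗ₜ b, ?_⟩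
    simp [incl_tmul, TensorProduct.smul_tmul']
  | add a b ha hb =>
    rw [map_add, smul_add]
    exact add_mem ha hb

theorem sigmaHat_mem (b c : C) : D.sigmaHat σ (b ⊗ₜ c) ∈ LinearMap.range D.incl := by
  simp only [sigmaHat, hat, LinearMap.rTensor_comp, LinearMap.comp_apply]
  exact ⟨_, rfl⟩

theorem mulExt_sigmaHat_mem {t : P ⊗[k] C} (ht : t ∈ LinearMap.range D.incl) (c : C) :
    mulExt (D.sigmaHat σ) (t ⊗ₜ c) ∈ LinearMap.range D.incl := by
  obtain ⟨w, rfl⟩ := ht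
  induction w with
  | zero => simp
  | tmul a b =>
    rw [incl_tmul, mulExt_tmul]
    exact smul_mem_range a.2 (sigmaHat_mem b c)
  | add a b ha hb =>
    rw [map_add, TensorProduct.add_tmul, map_add]
    exact add_mem ha hb

theorem IsCrossedProductData.mul_mem (h : D.IsCrossedProductData ρ σ)
    (t : (D.M ⊗[k] C) ⊗[k] (D.M ⊗[k] C)) :
    (D.mulFormula ρ σ ∘ₗ TensorProduct.map D.incl D.incl) t ∈ LinearMap.range D.incl := by
  induction t with
  | zero => simp
  | add a b ha hb => rw [map_add]; exact add_mem ha hb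
  | tmul t s =>
    simp only [LinearMap.comp_apply, TensorProduct.map_tmul]
    induction s with
    | zero => simp
    | add a b ha hb => rw [map_add, TensorProduct.tmul_add, map_add]; exact add_mem ha hb
    | tmul y c =>
      rw [incl_tmul, mulFormula_tmul]
      apply mulExt_sigmaHat_mem
      induction t with
      | zero => simp
      | add a b ha hb => rw [map_add, TensorProduct.add_tmul, map_add]; exact add_mem ha hb
      | tmul x b =>
        rw [incl_tmul, mulExt_tmul]
        exact smul_mem_range x.2 (h.rho_mem b y y.2)

/-- The product on `M ⊗ C`: the restriction of `mulFormula`. -/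
def crossedMul (h : D.IsCrossedProductData ρ σ) :
    (D.M ⊗[k] C) ⊗[k] (D.M ⊗[k] C) →ₗ[k] D.M ⊗[k] C :=
  (LinearEquiv.ofInjective D.incl D.incl_injective).symm.toLinearMap ∘ₗ
    LinearMap.codRestrict (LinearMap.range D.incl)
      (D.mulFormula ρ σ ∘ₗ TensorProduct.map D.incl D.incl) h.mul_mem

theorem incl_crossedMul (h : D.IsCrossedProductData ρ σ) (t s : D.M ⊗[k] C) :
    D.incl (crossedMul h (t ⊗ₜ s)) = D.mulFormula ρ σ (D.incl t ⊗ₜ D.incl s) := by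
  have : ∀ r : LinearMap.range D.incl,
      D.incl ((LinearEquiv.ofInjective D.incl D.incl_injective).symm r) = r := fun r => by
    rw [← LinearEquiv.ofInjective_apply (h := D.incl_injective), LinearEquiv.apply_symm_apply]
  simp [crossedMul, this]

namespace IsCrossedProductData

theorem mulFormula_rhoHat (h : D.IsCrossedProductData ρ σ)
    (t : P ⊗[k] C) (b : C) (x : P) (hx : x ∈ D.M) :
    D.mulFormula ρ σ (t ⊗ₜ D.rhoHat ρ (b ⊗ₜ x)) =
      mulExt (D.rhoHat ρ) (mulExt (D.sigmaHat σ) (t ⊗ₜ b) ⊗ₜ x) := by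
  induction t with
  | zero => simp
  | add a b ha hb => simp only [TensorProduct.add_tmul, map_add, ha, hb]
  | tmul p a =>
    have : p ⊗ₜ[k] a = p • (1 ⊗ₜ[k] a : P ⊗[k] C) := by simp [TensorProduct.smul_tmul']
    rw [mulExt_tmul, mulExt_smul, this, mulFormula_smul, mulFormula_one_tmul, h.twisted_module a b x hx]

theorem mulFormula_sigmaHat (h : D.IsCrossedProductData ρ σ) (t : P ⊗[k] C) (b c : C) :
    D.mulFormula ρ σ (t ⊗ₜ D.sigmaHat σ (b ⊗ₜ c)) =
      mulExt (D.sigmaHat σ) (mulExt (D.sigmaHat σ) (t ⊗ₜ b) ⊗ₜ c) := by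
  induction t with
  | zero => simp
  | add a b ha hb => simp only [TensorProduct.add_tmul, map_add, ha, hb]
  | tmul p a =>
    have : p ⊗ₜ[k] a = p • (1 ⊗ₜ[k] a : P ⊗[k] C) := by simp [TensorProduct.smul_tmul']
    rw [mulExt_tmul, mulExt_smul, this, mulFormula_smul, mulFormula_one_tmul, h.cocycle a b c]

theorem mulExt_rhoHat_mul (h : D.IsCrossedProductData ρ σ)
    (t : P ⊗[k] C) (x y : P) (hx : x ∈ D.M) (hy : y ∈ D.M) :
    mulExt (D.rhoHat ρ) (t ⊗ₜ (x * y)) = mulExt (D.rhoHat ρ) (mulExt (D.rhoHat ρ) (t ⊗ₜ x) ⊗ₜ y) := by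
  induction t with
  | zero => simp
  | add a b ha hb => simp only [TensorProduct.add_tmul, map_add, ha, hb]
  | tmul p a => rw [mulExt_tmul, mulExt_tmul, mulExt_smul, h.rho_mul a x hx y hy]

theorem mulFormula_smul_right (h : D.IsCrossedProductData ρ σ)
    (t : P ⊗[k] C) (u : P) (hu : u ∈ D.M) (s : P ⊗[k] C)
    (hs : s ∈ LinearMap.range D.incl) :
    D.mulFormula ρ σ (t ⊗ₜ (u • s)) = D.mulFormula ρ σ (mulExt (D.rhoHat ρ) (t ⊗ₜ u) ⊗ₜ s) := by
  obtain ⟨w, rfl⟩ := hs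
  induction w with
  | zero => simp
  | add a b ha hb => simp only [smul_add, TensorProduct.tmul_add, map_add, ha, hb]
  | tmul m c =>
    rw [incl_tmul, TensorProduct.smul_tmul', smul_eq_mul, mulFormula_tmul, mulFormula_tmul,
      h.mulExt_rhoHat_mul t u m hu m.2]

theorem mulFormula_ext (h : D.IsCrossedProductData ρ σ)
    (t : P ⊗[k] C) (y : P) (hy : y ∈ D.M) (c : C) (w : P ⊗[k] C)
    (hw : w ∈ LinearMap.range D.incl) :
    D.mulFormula ρ σ (t ⊗ₜ (y • mulExt (D.sigmaHat σ) (w ⊗ₜ c))) =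
      mulExt (D.sigmaHat σ) (D.mulFormula ρ σ (mulExt (D.rhoHat ρ) (t ⊗ₜ y) ⊗ₜ w) ⊗ₜ c) := by
  obtain ⟨w, rfl⟩ := hw
  induction w with
  | zero => simp
  | add a b ha hb =>
    simp only [smul_add, TensorProduct.tmul_add, TensorProduct.add_tmul, map_add, ha, hb]
  | tmul m b =>
    rw [incl_tmul, mulExt_tmul, smul_smul,
      h.mulFormula_smul_right t (y * m) (D.M.mul_mem hy m.2) _ (sigmaHat_mem b c),
      h.mulFormula_sigmaHat, h.mulExt_rhoHat_mul t y m hy m.2, mulFormula_tmul]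

theorem crossedMul_assoc (h : D.IsCrossedProductData ρ σ) (r s t : D.M ⊗[k] C) :
    crossedMul h (crossedMul h (r ⊗ₜ s) ⊗ₜ t) = crossedMul h (r ⊗ₜ crossedMul h (s ⊗ₜ t)) := by
  apply D.incl_injective
  simp only [incl_crossedMul]
  generalize D.incl r = r
  induction t with
  | zero => simp
  | add a b ha hb => simp only [TensorProduct.tmul_add, map_add, ha, hb]
  | tmul z c =>
    induction s with
    | zero => simp
    | add a b ha hb =>
      simp only [TensorProduct.tmul_add, TensorProduct.add_tmul, map_add, ha, hb]
    | tmul y b =>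
      rw [incl_tmul, incl_tmul, mulFormula_tmul, mulFormula_tmul, mulFormula_tmul, mulExt_tmul,
        mulExt_smul, h.mulFormula_ext r y y.2 c _ (h.rho_mem b z z.2),
        h.mulFormula_rhoHat _ b z z.2]

theorem crossedMul_one_left (h : D.IsCrossedProductData ρ σ)
    (t : D.M ⊗[k] C) : crossedMul h ((1 ⊗ₜ D.e) ⊗ₜ t) = t := by
  apply D.incl_injective
  rw [incl_crossedMul]
  induction t with
  | zero => simp
  | add a b ha hb => simp only [TensorProduct.tmul_add, map_add, ha, hb]
  | tmul y c =>
    have h1 : D.rhoHat ρ (D.e ⊗ₜ (y : P)) = (y : P) ⊗ₜ D.e := by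
      have : D.ψ (D.e ⊗ₜ (y : P)) = (y : P) ⊗ₜ D.e := y.2
      simp [rhoHat, hat, D.e_groupLike.comul_eq_tmul_self, this, h.rho_e y y.2]
    have h2 : D.sigmaHat σ (D.e ⊗ₜ c) = 1 ⊗ₜ c := by
      simp only [sigmaHat, hat, LinearMap.comp_apply, LinearEquiv.coe_coe,
        LinearMap.rTensor_tmul, D.e_groupLike.comul_eq_tmul_self, TensorProduct.assoc_tmul,
        LinearMap.lTensor_tmul, D.ψC_e]
      have h3 := Coalgebra.rTensor_counit_comul (R := k) c
      have : ∀ s : C ⊗[k] C,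
          (D.M.val.toLinearMap ∘ₗ σ).rTensor C
              ((TensorProduct.assoc k C C C).symm (D.e ⊗ₜ s)) =
            (Algebra.linearMap k P).rTensor C
              ((Coalgebra.counit (R := k) (A := C)).rTensor C s) := by
        intro s
        induction s with
        | zero => simp
        | add a b ha hb => simp only [TensorProduct.tmul_add, map_add, ha, hb]
        | tmul a b => simp [h.sigma_e]
      rw [this, h3]
      simp
    rw [incl_tmul, incl_tmul, mulFormula_tmul, mulExt_tmul, h1]
    simp [mulExt_tmul, h2, TensorProduct.smul_tmul']

theorem crossedMul_one_right (h : D.IsCrossedProductData ρ σ)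
    (t : D.M ⊗[k] C) : crossedMul h (t ⊗ₜ (1 ⊗ₜ D.e)) = t := by
  apply D.incl_injective
  rw [incl_crossedMul]
  induction t with
  | zero => simp
  | add a b ha hb => simp only [TensorProduct.add_tmul, map_add, ha, hb]
  | tmul y c =>
    have h1 : D.rhoHat ρ (c ⊗ₜ (1 : P)) = 1 ⊗ₜ c := by
      simp only [rhoHat, hat, LinearMap.comp_apply, LinearEquiv.coe_coe, LinearMap.rTensor_tmul]
      have h3 := Coalgebra.rTensor_counit_comul (R := k) c
      have : ∀ s : C ⊗[k] C,
          ρ.rTensor C ((TensorProduct.assoc k C P C).symm (D.ψ.lTensor C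
              (TensorProduct.assoc k C C P (s ⊗ₜ 1)))) =
            (Algebra.linearMap k P).rTensor C
              ((Coalgebra.counit (R := k) (A := C)).rTensor C s) := by
        intro s
        induction s with
        | zero => simp
        | add a b ha hb => simp only [TensorProduct.add_tmul, map_add, ha, hb]
        | tmul a b => simp [h.rho_one, D.ψ_alg.one]
      rw [this, h3]
      simp
    rw [incl_tmul, incl_tmul, mulFormula_tmul, mulExt_tmul, OneMemClass.coe_one, h1, mulExt_smul,
      mulExt_tmul, h.sigma_hat_e]
    simp [TensorProduct.smul_tmul']

end IsCrossedProductData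

/-- The crossed product `M ⋊_{ρ,σ} C`: the vector space `M ⊗ C` with the product
`(x ⊗ b)(y ⊗ c) = x ρ (b₁, y_α) σ (b₂^α₁, c_A) ⊗ b₂^α₂^A` and the unit `1 ⊗ e`. -/
def CrossedProduct {D : EntwiningData k C P} {ρ : C ⊗[k] P →ₗ[k] P} {σ : C ⊗[k] C →ₗ[k] D.M}
    (_h : D.IsCrossedProductData ρ σ) : Type _ :=
  D.M ⊗[k] C

namespace CrossedProduct

variable (h : D.IsCrossedProductData ρ σ)

instance : AddCommGroup (CrossedProduct h) := inferInstanceAs (AddCommGroup (D.M ⊗[k] C))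

instance : Module k (CrossedProduct h) := inferInstanceAs (Module k (D.M ⊗[k] C))

/-- The identification of the vector space `M ⊗ C` with the crossed product. -/
def of : D.M ⊗[k] C ≃ₗ[k] CrossedProduct h := LinearEquiv.refl k _

instance : Ring (CrossedProduct h) :=
  { (inferInstance : AddCommGroup (CrossedProduct h)) with
    mul := fun s t => of h (crossedMul h ((of h).symm s ⊗ₜ (of h).symm t))
    one := of h (1 ⊗ₜ D.e)
    mul_assoc := fun r s t => h.crossedMul_assoc r s t
    one_mul := fun t => h.crossedMul_one_left t
    mul_one := fun t => h.crossedMul_one_right t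
    zero_mul := fun t => by
      change crossedMul h (0 ⊗ₜ _) = 0
      simp
    mul_zero := fun t => by
      change crossedMul h (_ ⊗ₜ 0) = 0
      simp
    left_distrib := fun r s t => by
      exact (congrArg (crossedMul h) (TensorProduct.tmul_add ((of h).symm r) ((of h).symm s)
        ((of h).symm t))).trans (map_add _ _ _)
    right_distrib := fun r s t => by
      exact (congrArg (crossedMul h) (TensorProduct.add_tmul ((of h).symm r) ((of h).symm s)
        ((of h).symm t))).trans (map_add _ _ _) }

instance : Algebra k (CrossedProduct h) :=
  Algebra.ofModule
    (fun r s t => by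
      change crossedMul h ((r • (of h).symm s) ⊗ₜ (of h).symm t) = r • crossedMul h _
      rw [← TensorProduct.smul_tmul', map_smul])
    (fun r s t => by
      change crossedMul h ((of h).symm s ⊗ₜ (r • (of h).symm t)) = r • crossedMul h _
      rw [TensorProduct.tmul_smul, map_smul])

theorem of_mul_of (s t : D.M ⊗[k] C) :
    of h s * of h t = of h (crossedMul h (s ⊗ₜ t)) := rfl

theorem one_eq : (1 : CrossedProduct h) = of h (1 ⊗ₜ D.e) := rfl

end CrossedProduct

end Product

section Cleft

/-- `Φ : C → P` is covariant: `ψ ∘ (id_C ⊗ Φ) = (Φ ⊗ id_C) ∘ ψ^C`. -/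
def IsCovariant (D : EntwiningData k C P) (Φ : C →ₗ[k] P) : Prop :=
  D.ψ ∘ₗ Φ.lTensor C = Φ.rTensor C ∘ₗ D.ψC

/-- For `Φ, Φ' : C → P` and `φ : C ⊗ P → P ⊗ C`, the map
`c ⊗ u ↦ Φ (c₁) u_α Φ' (c₂^α)`; applied to `Φ' = Φ⁻¹` it is the map `ρ` of the cleft extension. -/
def cleftRho (D : EntwiningData k C P) (Φ Φ' : C →ₗ[k] P) : C ⊗[k] P →ₗ[k] P :=
  LinearMap.mul' k P ∘ₗ
    TensorProduct.map Φ (LinearMap.mul' k P ∘ₗ Φ'.lTensor P ∘ₗ D.ψ) ∘ₗ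
      (TensorProduct.assoc k C C P).toLinearMap ∘ₗ
        (Coalgebra.comul (R := k) (A := C)).rTensor P

/-- The map `b ⊗ c ↦ Φ (b₁) Φ (c_A) Φ' (b₂^A)`; applied to `Φ' = Φ⁻¹` it is the map `σ` of the
cleft extension. -/
def cleftSigma (D : EntwiningData k C P) (Φ Φ' : C →ₗ[k] P) : C ⊗[k] C →ₗ[k] P :=
  LinearMap.mul' k P ∘ₗ
    TensorProduct.map Φ (LinearMap.mul' k P ∘ₗ TensorProduct.map Φ Φ' ∘ₗ D.ψC) ∘ₗ
      (TensorProduct.assoc k C C C).toLinearMap ∘ₗ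
        (Coalgebra.comul (R := k) (A := C)).rTensor C

end Cleft

end EntwiningData

section Euclidean

/-- The generators `v, v⁻¹, n, n̄` of `E_q(2)`. -/
inductive EGen : Type
  | v | vinv | n | nbar

/-- The defining relations of `E_q(2)`. -/
inductive ERel {k : Type*} [Field k] (q : k) : FreeAlgebra k EGen → FreeAlgebra k EGen → Prop
  | v_n : ERel q (.ι k .v * .ι k .n) (q ^ 2 • (.ι k .n * .ι k .v))
  | v_nbar : ERel q (.ι k .v * .ι k .nbar) (q ^ 2 • (.ι k .nbar * .ι k .v))
  | n_nbar : ERel q (.ι k .n * .ι k .nbar) (q ^ 2 • (.ι k .nbar * .ι k .n))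
  | v_vinv : ERel q (.ι k .v * .ι k .vinv) 1
  | vinv_v : ERel q (.ι k .vinv * .ι k .v) 1

/-- The two-dimensional quantum Euclidean group `E_q(2)`. -/
abbrev E {k : Type*} [Field k] (q : k) : Type _ := RingQuot (ERel q)

/-- The generators of the quantum hyperboloid. -/
inductive XGen : Type
  | z | zbar

/-- The defining relation `z z̄ = q² z̄ z + (1 - q²)` of the quantum hyperboloid. -/
inductive XRel {k : Type*} [Field k] (q : k) : FreeAlgebra k XGen → FreeAlgebra k XGen → Prop
  | z_zbar : XRel q (.ι k .z * .ι k .zbar)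
      (q ^ 2 • (.ι k .zbar * .ι k .z) + algebraMap k _ (1 - q ^ 2))

/-- The quantum hyperboloid `X_q`. -/
abbrev X {k : Type*} [Field k] (q : k) : Type _ := RingQuot (XRel q)

variable {k : Type*} [Field k]

/-- A generator of `E_q(2)`. -/
def E.gen (q : k) (g : EGen) : E q := RingQuot.mkAlgHom k (ERel q) (FreeAlgebra.ι k g)

/-- A generator of `X_q`. -/
def X.gen (q : k) (g : XGen) : X q := RingQuot.mkAlgHom k (XRel q) (FreeAlgebra.ι k g)

/-- `v` as an invertible element of `E_q(2)`, with inverse the generator `v⁻¹`. -/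
def E.vUnit (q : k) : (E q)ˣ where
  val := E.gen q .v
  inv := E.gen q .vinv
  val_inv := by
    simpa [E.gen] using RingQuot.mkAlgHom_rel k (ERel.v_vinv (q := q))
  inv_val := by
    simpa [E.gen] using RingQuot.mkAlgHom_rel k (ERel.vinv_v (q := q))

/-- The coalgebra `C` with basis `c_p`, `p ∈ ℤ`: Mathlib's coalgebra structure on `ℤ →₀ k` makes
all `c_p` group-like. -/
abbrev CZ (k : Type*) [Field k] : Type _ := ℤ →₀ k

/-- The basis element `c_p`. -/
def CZ.c (k : Type*) [Field k] (p : ℤ) : CZ k := Finsupp.single p 1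

/-- The linear map `Φ : C → E_q(2)` with `Φ (c_p) = v ^ (p - s)`. -/
def Phi (q : k) (s : ℤ) : CZ k →ₗ[k] E q :=
  Finsupp.linearCombination k fun p : ℤ => ((E.vUnit q ^ (p - s) : (E q)ˣ) : E q)

/-- The prescribed values of the entwining map on the generators of `E_q(2)`. -/
structure HasGenValues (q μ ν : k) (ψ : CZ k ⊗[k] E q →ₗ[k] E q ⊗[k] CZ k) : Prop where
  v : ∀ p : ℤ, ψ (CZ.c k p ⊗ₜ E.gen q .v) = E.gen q .v ⊗ₜ CZ.c k (p + 1)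
  vinv : ∀ p : ℤ, ψ (CZ.c k p ⊗ₜ E.gen q .vinv) = E.gen q .vinv ⊗ₜ CZ.c k (p - 1)
  n : ∀ p : ℤ, ψ (CZ.c k p ⊗ₜ E.gen q .n) =
    E.gen q .n ⊗ₜ CZ.c k p + (μ * q ^ (2 * p)) • (E.gen q .v ⊗ₜ CZ.c k p)
      - (μ * q ^ (2 * p)) • (E.gen q .v ⊗ₜ CZ.c k (p + 1))
  nbar : ∀ p : ℤ, ψ (CZ.c k p ⊗ₜ E.gen q .nbar) =
    E.gen q .nbar ⊗ₜ CZ.c k p + (ν * q ^ (2 * p)) • (E.gen q .vinv ⊗ₜ CZ.c k p)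
      - (ν * q ^ (2 * p)) • (E.gen q .vinv ⊗ₜ CZ.c k (p - 1))

end Euclidean

end CoalgCrossed

end

open CoalgCrossed

/-! Write `P = E_q(2)`. A map `ψ` satisfying (A) is the same thing as a right action of `P` on `P ⊗
C` commuting with left multiplication, via `ψ (c ⊗ u) = (1 ⊗ c) u`. Existence of `ψ` thus amounts to
checking the defining relations of `P` on left-linear endomorphisms of a free module
(`ActionData.toEnd`); uniqueness holds because (A) determines `ψ` from its values on generators.

Everything else rests on the subspaces `P_{p,r} = {u | ψ (c_p ⊗ u) = u ⊗ c_r}` (`homogeneous`). By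
(A), `P_{p,r} P_{r,t} ⊆ P_{p,t}`. Moreover `v^{r-p} ∈ P_{p,r}` and `n + μ q^{2p} v, n̄ + ν q^{2p}
v⁻¹ ∈ P_{p,p}`, so for each fixed `p` the `P_{p,r}` span `P` (`HasGenValues.mem_iSup_homogeneous`).
On such vectors (B) is immediate, the `c_p` being group-like.

Here `M = P_{s,s}` and `P_{s,r} = M v^{r-s}`. Hence `θ : x ⊗ c ↦ x Φ(c)` is a bijection `M ⊗ C → P`.
Since `θ (ρ̂ (c ⊗ u)) = Φ(c) u` and `θ (σ̂ (b ⊗ c)) = Φ(b) Φ(c)`, the product formula goes over to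
the product of `P` (`theta_mulFormula`). Multiplicativity, the cocycle condition and the twisted
module condition each compare two elements of `M ⊗ C` with the same image under `θ`, by
associativity of `P`, so they follow from injectivity (`eq_of_theta_eq`).

For `X_q ≅ M`, a second right action of `P`, on `X_q ⊗ C` with `c_p` playing the role of `v^p`,
shows that `X_q → P` is injective: its image acts on `X_q ⊗ c_0` by right multiplication. For
surjectivity, the products of elements of the image with powers of `v` span `P`, and injectivity of
`θ` singles out the part lying in `M`. -/

noncomputable section

namespace CoalgCrossed

/-! ### Free modules over the group-like coalgebra -/

section FreeModule

variable {k : Type*} [Field k] {A : Type*} [Ring A] [Algebra k A]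

/-- The left `A`-linear endomorphism of the free module `A ⊗ C` with `1 ⊗ c_p ↦ f p`. -/
def freeEnd (f : ℤ → A ⊗[k] CZ k) : Module.End A (A ⊗[k] CZ k) :=
  TensorProduct.AlgebraTensorModule.lift
    (LinearMap.toSpanSingleton A _ (Finsupp.linearCombination k f))

theorem freeEnd_tmul (f : ℤ → A ⊗[k] CZ k) (a : A) (p : ℤ) :
    freeEnd f (a ⊗ₜ CZ.c k p) = a • f p := by
  simp [freeEnd, CZ.c]

theorem freeEnd_ext {f g : Module.End A (A ⊗[k] CZ k)}
    (h : ∀ p, f (1 ⊗ₜ CZ.c k p) = g (1 ⊗ₜ CZ.c k p)) : f = g := by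
  apply TensorProduct.AlgebraTensorModule.curry_injective
  ext p
  exact h p

theorem CZ.hom_ext {N : Type*} [AddCommMonoid N] [Module k N] {f g : CZ k →ₗ[k] N}
    (h : ∀ p, f (CZ.c k p) = g (CZ.c k p)) : f = g := by
  ext p
  exact h p

theorem CZ.tmul_hom_ext {Q N : Type*} [AddCommMonoid Q] [Module k Q] [AddCommMonoid N] [Module k N]
    {f g : CZ k ⊗[k] Q →ₗ[k] N}
    (h : ∀ p u, f (CZ.c k p ⊗ₜ u) = g (CZ.c k p ⊗ₜ u)) : f = g := by
  ext p u
  exact h p u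

theorem CZ.tmul_c_hom_ext {N : Type*} [AddCommMonoid N] [Module k N]
    {f g : CZ k ⊗[k] CZ k →ₗ[k] N}
    (h : ∀ p r, f (CZ.c k p ⊗ₜ CZ.c k r) = g (CZ.c k p ⊗ₜ CZ.c k r)) : f = g := by
  ext p r
  exact h p r

theorem CZ.comul_c (p : ℤ) :
    Coalgebra.comul (R := k) (CZ.c k p) = CZ.c k p ⊗ₜ CZ.c k p := by
  simp [CZ.c]

theorem CZ.counit_c (p : ℤ) : Coalgebra.counit (R := k) (CZ.c k p) = 1 := by
  simp [CZ.c]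

theorem CZ.isGroupLikeElem (p : ℤ) : IsGroupLikeElem k (CZ.c k p) :=
  ⟨CZ.counit_c p, CZ.comul_c p⟩

end FreeModule

/-! ### Generators, universal properties and commutation rules -/

section Generators

variable {k : Type*} [Field k] (q : k)

/-- A subalgebra of `E_q(2)` containing the generators is everything. -/
theorem E.mem_of_gen_mem {S : Subalgebra k (E q)} (h : ∀ g, E.gen q g ∈ S) (u : E q) : u ∈ S := by
  obtain ⟨w, rfl⟩ := RingQuot.mkAlgHom_surjective k (ERel q) u
  induction w using FreeAlgebra.induction with
  | grade0 r => rw [AlgHom.commutes]; exact S.algebraMap_mem r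
  | grade1 g => exact h g
  | mul a b ha hb => rw [map_mul]; exact S.mul_mem ha hb
  | add a b ha hb => rw [map_add]; exact S.add_mem ha hb

/-- A subalgebra of `X_q` containing the generators is everything. -/
theorem X.mem_of_gen_mem {S : Subalgebra k (X q)} (h : ∀ g, X.gen q g ∈ S) (u : X q) : u ∈ S := by
  obtain ⟨w, rfl⟩ := RingQuot.mkAlgHom_surjective k (XRel q) u
  induction w using FreeAlgebra.induction with
  | grade0 r => rw [AlgHom.commutes]; exact S.algebraMap_mem r
  | grade1 g => exact h g
  | mul a b ha hb => rw [map_mul]; exact S.mul_mem ha hb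
  | add a b ha hb => rw [map_add]; exact S.add_mem ha hb

variable {q}

/-- The universal property of `E_q(2)`. -/
def E.lift {B : Type*} [Ring B] [Algebra k B] (f : EGen → B)
    (v_n : f .v * f .n = q ^ 2 • (f .n * f .v))
    (v_nbar : f .v * f .nbar = q ^ 2 • (f .nbar * f .v))
    (n_nbar : f .n * f .nbar = q ^ 2 • (f .nbar * f .n))
    (v_vinv : f .v * f .vinv = 1) (vinv_v : f .vinv * f .v = 1) : E q →ₐ[k] B :=
  RingQuot.liftAlgHom k ⟨FreeAlgebra.lift k f, by
    rintro x y (_ | _ | _ | _ | _) <;> simpa⟩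

theorem E.lift_gen {B : Type*} [Ring B] [Algebra k B] (f : EGen → B)
    (v_n : f .v * f .n = q ^ 2 • (f .n * f .v))
    (v_nbar : f .v * f .nbar = q ^ 2 • (f .nbar * f .v))
    (n_nbar : f .n * f .nbar = q ^ 2 • (f .nbar * f .n))
    (v_vinv : f .v * f .vinv = 1) (vinv_v : f .vinv * f .v = 1) (g : EGen) :
    E.lift f v_n v_nbar n_nbar v_vinv vinv_v (E.gen q g) = f g := by
  simp [E.lift, E.gen]

/-- The universal property of `X_q`. -/
def X.lift {B : Type*} [Ring B] [Algebra k B] (f : XGen → B)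
    (z_zbar : f .z * f .zbar = q ^ 2 • (f .zbar * f .z) + algebraMap k B (1 - q ^ 2)) :
    X q →ₐ[k] B :=
  RingQuot.liftAlgHom k ⟨FreeAlgebra.lift k f, by
    rintro x y (_ | _)
    simpa only [map_add, map_smul, map_mul, FreeAlgebra.lift_ι_apply, AlgHom.commutes]⟩

theorem X.lift_gen {B : Type*} [Ring B] [Algebra k B] (f : XGen → B)
    (z_zbar : f .z * f .zbar = q ^ 2 • (f .zbar * f .z) + algebraMap k B (1 - q ^ 2)) (g : XGen) :
    X.lift f z_zbar (X.gen q g) = f g := by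
  simp [X.lift, X.gen]

theorem E.v_mul_n : E.gen q .v * E.gen q .n = q ^ 2 • (E.gen q .n * E.gen q .v) := by
  simpa [E.gen] using RingQuot.mkAlgHom_rel k (ERel.v_n (q := q))

theorem E.v_mul_nbar : E.gen q .v * E.gen q .nbar = q ^ 2 • (E.gen q .nbar * E.gen q .v) := by
  simpa [E.gen] using RingQuot.mkAlgHom_rel k (ERel.v_nbar (q := q))

theorem E.n_mul_nbar : E.gen q .n * E.gen q .nbar = q ^ 2 • (E.gen q .nbar * E.gen q .n) := by
  simpa [E.gen] using RingQuot.mkAlgHom_rel k (ERel.n_nbar (q := q))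

theorem E.v_mul_vinv : E.gen q .v * E.gen q .vinv = 1 := (E.vUnit q).mul_inv

theorem E.vinv_mul_v : E.gen q .vinv * E.gen q .v = 1 := (E.vUnit q).inv_mul

theorem E.n_mul_vinv : E.gen q .n * E.gen q .vinv = q ^ 2 • (E.gen q .vinv * E.gen q .n) := by
  -- Putting `v⁻¹` on both sides of `v n = q² n v` moves the relation to `v⁻¹` without dividing by
  -- `q`.
  have := congrArg (fun x => E.gen q .vinv * x * E.gen q .vinv) (E.v_mul_n (q := q))
  simp only [← mul_assoc, E.vinv_mul_v, one_mul, mul_smul_comm, smul_mul_assoc] at this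
  rw [this]
  simp only [mul_assoc, E.v_mul_vinv, mul_one]

theorem E.nbar_mul_vinv :
    E.gen q .nbar * E.gen q .vinv = q ^ 2 • (E.gen q .vinv * E.gen q .nbar) := by
  have := congrArg (fun x => E.gen q .vinv * x * E.gen q .vinv) (E.v_mul_nbar (q := q))
  simp only [← mul_assoc, E.vinv_mul_v, one_mul, mul_smul_comm, smul_mul_assoc] at this
  rw [this]
  simp only [mul_assoc, E.v_mul_vinv, mul_one]

/-- An element `x` with `v x = q² x v` satisfies `v ^ m x = q ^ (2 m) x v ^ m`. -/
theorem E.zpow_mul (hq : q ≠ 0) {x : E q} (hx : E.gen q .v * x = q ^ 2 • (x * E.gen q .v))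
    (m : ℤ) : ((E.vUnit q ^ m : (E q)ˣ) : E q) * x =
      q ^ (2 * m) • (x * ((E.vUnit q ^ m : (E q)ˣ) : E q)) := by
  have h2 : q ^ 2 ≠ 0 := pow_ne_zero 2 hq
  have hx' : E.gen q .vinv * x = (q ^ 2)⁻¹ • (x * E.gen q .vinv) := by
    rw [eq_inv_smul_iff₀ h2]
    have := congrArg (fun y => E.gen q .vinv * y * E.gen q .vinv) hx
    simp only [← mul_assoc, E.vinv_mul_v, one_mul, mul_smul_comm, smul_mul_assoc] at this
    rw [this]
    simp only [mul_assoc, E.v_mul_vinv, mul_one]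
  induction m with
  | zero => simp
  | succ i ih =>
    rw [zpow_add_one, Units.val_mul]
    change _ * E.gen q .v * x = _ • (x * (_ * E.gen q .v))
    rw [mul_assoc, hx, mul_smul_comm, ← mul_assoc, ih, smul_mul_assoc, smul_smul, mul_assoc]
    congr 1
    rw [← zpow_natCast, ← zpow_add₀ hq]
    congr 1
    push_cast
    ring
  | pred i ih =>
    rw [zpow_sub_one, Units.val_mul]
    change _ * E.gen q .vinv * x = _ • (x * (_ * E.gen q .vinv))
    rw [mul_assoc, hx', mul_smul_comm, ← mul_assoc, ih, smul_mul_assoc, smul_smul, mul_assoc]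
    congr 1
    rw [← zpow_natCast, ← zpow_neg, ← zpow_add₀ hq]
    congr 1
    push_cast
    ring

end Generators

/-! ### Right actions of `E_q(2)` by generators and relations -/

section RightAction

variable {k : Type*} [Field k] {q : k} {A : Type*} [Ring A] [Algebra k A]

/-- Data for a right action of `E_q(2)` on the free left module `A ⊗ C`:
`c_p v = α c_{p+1}`, `c_p n = β_p c_p - γ_p c_{p+1}`, `c_p n̄ = β'_p c_p - γ'_p c_{p-1}`. -/
structure ActionData (q : k) (A : Type*) [Ring A] [Algebra k A] where
  α : Aˣ
  β : ℤ → A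
  γ : ℤ → A
  β' : ℤ → A
  γ' : ℤ → A
  -- These four conditions are the coefficients of `v n = q² n v` and `v n̄ = q² n̄ v` applied to
  -- `c_p`.
  α_β : ∀ p, α * β (p + 1) = q ^ 2 • (β p * α)
  α_γ : ∀ p, α * γ (p + 1) = q ^ 2 • (γ p * α)
  α_β' : ∀ p, α * β' (p + 1) = q ^ 2 • (β' p * α)
  α_γ' : ∀ p, α * γ' (p + 1) = q ^ 2 • (γ' p * α)
  -- The last three are the coefficients of `n n̄ = q² n̄ n` applied to `c_p`, at `c_{p-1}`,
  -- `c_{p+1}` and `c_p` respectively.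
  β_γ' : ∀ p, β p * γ' p = q ^ 2 • (γ' p * β (p - 1))
  γ_β' : ∀ p, γ p * β' (p + 1) = q ^ 2 • (β' p * γ p)
  β_β' : ∀ p, β p * β' p + γ p * γ' (p + 1) = q ^ 2 • (β' p * β p + γ' p * γ (p - 1))

namespace ActionData

variable (a : ActionData q A)

/-- The action of a generator on a basis element. -/
def genAct : EGen → ℤ → A ⊗[k] CZ k
  | .v, p => (a.α : A) ⊗ₜ CZ.c k (p + 1)
  | .vinv, p => ((a.α⁻¹ : Aˣ) : A) ⊗ₜ CZ.c k (p - 1)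
  | .n, p => a.β p ⊗ₜ CZ.c k p - a.γ p ⊗ₜ CZ.c k (p + 1)
  | .nbar, p => a.β' p ⊗ₜ CZ.c k p - a.γ' p ⊗ₜ CZ.c k (p - 1)

/-- The right action as an algebra map. -/
def toEnd : E q →ₐ[k] (Module.End A (A ⊗[k] CZ k))ᵐᵒᵖ :=
  E.lift (fun g => MulOpposite.op (freeEnd (a.genAct g)))
    -- Left linearity reduces each relation to the vectors `1 ⊗ c_p`. In the opposite algebra a
    -- product `u w` acts by `u` first.
    (MulOpposite.unop_injective <| freeEnd_ext fun p => by
      simp only [MulOpposite.unop_mul, MulOpposite.unop_smul, MulOpposite.unop_op,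
        Module.End.mul_apply, LinearMap.smul_apply, freeEnd_tmul, one_smul, genAct,
        map_sub, smul_sub, TensorProduct.smul_tmul', smul_eq_mul, a.α_β, a.α_γ])
    (MulOpposite.unop_injective <| freeEnd_ext fun p => by
      simp only [MulOpposite.unop_mul, MulOpposite.unop_smul, MulOpposite.unop_op,
        Module.End.mul_apply, LinearMap.smul_apply, freeEnd_tmul, one_smul, genAct,
        map_sub, smul_sub, TensorProduct.smul_tmul', smul_eq_mul, a.α_β', a.α_γ',
        add_sub_cancel_right, sub_add_cancel])
    (MulOpposite.unop_injective <| freeEnd_ext fun p => by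
      simp only [MulOpposite.unop_mul, MulOpposite.unop_smul, MulOpposite.unop_op,
        Module.End.mul_apply, LinearMap.smul_apply, freeEnd_tmul, one_smul, genAct,
        map_sub, smul_sub, TensorProduct.smul_tmul', smul_eq_mul, a.β_γ', a.γ_β',
        add_sub_cancel_right, sub_add_cancel]
      -- The terms at `c_{p-1}` and `c_{p+1}` have been brought to the same form on both sides; only
      -- the coefficient of `c_p` remains.
      have := congrArg (fun x : A => x ⊗ₜ[k] CZ.c k p) (a.β_β' p)
      simp only [smul_add, TensorProduct.add_tmul] at this
      linear_combination (norm := abel) this)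
    (MulOpposite.unop_injective <| freeEnd_ext fun p => by
      simp [freeEnd_tmul, genAct, TensorProduct.smul_tmul'])
    (MulOpposite.unop_injective <| freeEnd_ext fun p => by
      simp [freeEnd_tmul, genAct, TensorProduct.smul_tmul'])

theorem toEnd_gen (g : EGen) (x : A) (p : ℤ) :
    (a.toEnd (E.gen q g)).unop (x ⊗ₜ CZ.c k p) = x • a.genAct g p := by
  rw [toEnd, E.lift_gen, MulOpposite.unop_op, freeEnd_tmul]

end ActionData

end RightAction

/-! ### The entwining map, and the embedding of the hyperboloid -/

section Entwining

variable {k : Type*} [Field k] {q : k}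

theorem zpow_two_mul_succ (hq : q ≠ 0) (p : ℤ) : q ^ (2 * (p + 1)) = q ^ 2 * q ^ (2 * p) := by
  rw [← zpow_natCast, ← zpow_add₀ hq]
  congr 1
  push_cast
  ring

theorem zpow_two_mul_eq_pred (hq : q ≠ 0) (p : ℤ) :
    q ^ (2 * p) = q ^ 2 * q ^ (2 * (p - 1)) := by
  rw [← zpow_two_mul_succ hq, sub_add_cancel]

theorem zpow_two_mul_pred (hq : q ≠ 0) (p : ℤ) :
    q ^ (2 * (p - 1)) = (q ^ 2)⁻¹ * q ^ (2 * p) := by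
  rw [zpow_two_mul_eq_pred hq p, inv_mul_cancel_left₀ (pow_ne_zero 2 hq)]

theorem X.z_mul_zbar : X.gen q .z * X.gen q .zbar =
    q ^ 2 • (X.gen q .zbar * X.gen q .z) + (1 - q ^ 2) • 1 := by
  rw [← Algebra.algebraMap_eq_smul_one]
  simpa only [X.gen, map_add, map_smul, map_mul, AlgHom.commutes] using
    RingQuot.mkAlgHom_rel k (XRel.z_zbar (q := q))

namespace ActionData

/-- The map `c ⊗ u ↦ (1 ⊗ c) u` given by a right action of `E_q(2)` on `E_q(2) ⊗ C`. -/
def toEntwining (a : ActionData q (E q)) : CZ k ⊗[k] E q →ₗ[k] E q ⊗[k] CZ k :=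
  TensorProduct.lift (LinearMap.mk₂ k (fun c u => (a.toEnd u).unop (1 ⊗ₜ c))
    (fun c d u => by simp only [TensorProduct.tmul_add, map_add])
    (fun r c u => by simp only [TensorProduct.tmul_smul, LinearMap.map_smul_of_tower])
    (fun c u w => by simp only [map_add, MulOpposite.unop_add, LinearMap.add_apply])
    (fun r c u => by simp only [map_smul, MulOpposite.unop_smul, LinearMap.smul_apply]))

variable (a : ActionData q (E q))

theorem toEntwining_tmul (c : CZ k) (u : E q) :
    a.toEntwining (c ⊗ₜ u) = (a.toEnd u).unop (1 ⊗ₜ c) := rfl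

theorem toEntwining_gen (p : ℤ) (g : EGen) :
    a.toEntwining (CZ.c k p ⊗ₜ E.gen q g) = a.genAct g p := by
  rw [toEntwining_tmul, toEnd_gen, one_smul]

/-- Left linearity of the action identifies the extension of `ψ` to `P ⊗ C` with the action itself.
Condition (A) then reads `c (u w) = (c u) w` and `c 1 = c`. -/
theorem mulExt_toEntwining (t : E q ⊗[k] CZ k) (w : E q) :
    mulExt a.toEntwining (t ⊗ₜ w) = (a.toEnd w).unop t := by
  induction t with
  | zero => simp
  | tmul p c => rw [mulExt_tmul, toEntwining_tmul, ← map_smul, TensorProduct.smul_tmul',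
      smul_eq_mul, mul_one]
  | add x y hx hy => rw [TensorProduct.add_tmul, map_add, map_add, hx, hy]

theorem toEntwining_compatibleAlg : CompatibleAlg a.toEntwining where
  mul := by
    refine CZ.tmul_hom_ext fun p t => ?_
    induction t with
    | zero => simp
    | tmul u w =>
      simp [mulExt_toEntwining, toEntwining_tmul]
    | add x y hx hy => rw [TensorProduct.tmul_add, map_add, map_add, hx, hy]
  one c := by simp [toEntwining_tmul]

end ActionData

/-- The right action of `E_q(2)` on `E_q(2) ⊗ C` defining the entwining map. -/
def entwiningAction (μ ν : k) (hq : q ≠ 0) : ActionData q (E q) where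
  α := E.vUnit q
  β p := E.gen q .n + (μ * q ^ (2 * p)) • E.gen q .v
  γ p := (μ * q ^ (2 * p)) • E.gen q .v
  β' p := E.gen q .nbar + (ν * q ^ (2 * p)) • E.gen q .vinv
  γ' p := (ν * q ^ (2 * p)) • E.gen q .vinv
  α_β p := by
    change E.gen q .v * _ = q ^ 2 • (_ * E.gen q .v)
    simp only [zpow_two_mul_succ hq]
    simp only [mul_add, add_mul, mul_smul_comm, smul_mul_assoc, E.v_mul_n]
    module
  α_γ p := by
    change E.gen q .v * _ = q ^ 2 • (_ * E.gen q .v)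
    simp only [zpow_two_mul_succ hq]
    simp only [mul_smul_comm, smul_mul_assoc]
    module
  α_β' p := by
    change E.gen q .v * _ = q ^ 2 • (_ * E.gen q .v)
    simp only [zpow_two_mul_succ hq]
    simp only [mul_add, add_mul, mul_smul_comm, smul_mul_assoc, E.v_mul_nbar, E.v_mul_vinv,
      E.vinv_mul_v]
    module
  α_γ' p := by
    change E.gen q .v * _ = q ^ 2 • (_ * E.gen q .v)
    simp only [zpow_two_mul_succ hq]
    simp only [mul_smul_comm, smul_mul_assoc, E.v_mul_vinv, E.vinv_mul_v]
    module
  β_γ' p := by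
    simp only [zpow_two_mul_eq_pred hq p]
    simp only [mul_add, add_mul, mul_smul_comm, smul_mul_assoc, E.n_mul_vinv, E.v_mul_vinv,
      E.vinv_mul_v]
    module
  γ_β' p := by
    simp only [zpow_two_mul_succ hq]
    simp only [mul_add, add_mul, mul_smul_comm, smul_mul_assoc, E.v_mul_nbar, E.v_mul_vinv,
      E.vinv_mul_v]
    module
  β_β' p := by
    simp only [zpow_two_mul_succ hq, zpow_two_mul_pred hq]
    simp only [mul_add, add_mul, mul_smul_comm, smul_mul_assoc, E.v_mul_nbar, E.v_mul_vinv,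
      E.vinv_mul_v, E.n_mul_nbar, E.n_mul_vinv]
    match_scalars <;> field_simp
    ring

theorem hasGenValues_entwiningAction (μ ν : k) (hq : q ≠ 0) :
    HasGenValues q μ ν (entwiningAction μ ν hq).toEntwining where
  v p := ActionData.toEntwining_gen ..
  vinv p := ActionData.toEntwining_gen ..
  n p := by
    rw [ActionData.toEntwining_gen]
    simp [ActionData.genAct, entwiningAction, TensorProduct.add_tmul, TensorProduct.smul_tmul']
  nbar p := by
    rw [ActionData.toEntwining_gen]
    simp [ActionData.genAct, entwiningAction, TensorProduct.add_tmul, TensorProduct.smul_tmul']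

/-- The right action of `E_q(2)` on `X_q ⊗ C`, where `c_p` stands for `v ^ p`,
`z` for `v + a⁻¹ n` and `z̄` for `v⁻¹ + b⁻¹ n̄`. -/
def hyperboloidAction (a b : k) (hq : q ≠ 0) : ActionData q (X q) where
  α := 1
  β p := (a * q ^ (2 * p)) • X.gen q .z
  γ p := (a * q ^ (2 * p)) • 1
  β' p := (b * q ^ (2 * p)) • X.gen q .zbar
  γ' p := (b * q ^ (2 * p)) • 1
  α_β p := by
    simp only [zpow_two_mul_succ hq]
    simp only [Units.val_one, one_mul, mul_one]
    module
  α_γ p := by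
    simp only [zpow_two_mul_succ hq]
    simp only [Units.val_one, one_mul, mul_one]
    module
  α_β' p := by
    simp only [zpow_two_mul_succ hq]
    simp only [Units.val_one, one_mul, mul_one]
    module
  α_γ' p := by
    simp only [zpow_two_mul_succ hq]
    simp only [Units.val_one, one_mul, mul_one]
    module
  β_γ' p := by
    simp only [zpow_two_mul_eq_pred hq p]
    simp only [mul_smul_comm, smul_mul_assoc, one_mul, mul_one]
    module
  γ_β' p := by
    simp only [zpow_two_mul_succ hq]
    simp only [mul_smul_comm, smul_mul_assoc, one_mul, mul_one]
    module
  β_β' p := by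
    simp only [zpow_two_mul_succ hq, zpow_two_mul_pred hq]
    simp only [mul_smul_comm, smul_mul_assoc, mul_one, X.z_mul_zbar]
    match_scalars <;> field_simp
    ring

/-- The summand `v` contributes `y ⊗ c_1`, which cancels against the `γ`-term of `a⁻¹ n`. -/
theorem hyperboloidAction_z (a b : k) (hq : q ≠ 0) (ha : a ≠ 0) (y : X q) :
    ((hyperboloidAction a b hq).toEnd (E.gen q .v + a⁻¹ • E.gen q .n)).unop (y ⊗ₜ CZ.c k 0) =
      (y * X.gen q .z) ⊗ₜ CZ.c k 0 := by
  simp only [map_add, map_smul, MulOpposite.unop_add, MulOpposite.unop_smul, LinearMap.add_apply,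
    LinearMap.smul_apply, ActionData.toEnd_gen]
  simp [ActionData.genAct, hyperboloidAction, smul_sub, TensorProduct.smul_tmul', ha, smul_smul]

theorem hyperboloidAction_zbar (a b : k) (hq : q ≠ 0) (hb : b ≠ 0) (y : X q) :
    ((hyperboloidAction a b hq).toEnd (E.gen q .vinv + b⁻¹ • E.gen q .nbar)).unop
      (y ⊗ₜ CZ.c k 0) = (y * X.gen q .zbar) ⊗ₜ CZ.c k 0 := by
  simp only [map_add, map_smul, MulOpposite.unop_add, MulOpposite.unop_smul, LinearMap.add_apply,
    LinearMap.smul_apply, ActionData.toEnd_gen]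
  simp [ActionData.genAct, hyperboloidAction, smul_sub, TensorProduct.smul_tmul', hb, smul_smul]

/-- The algebra map `X_q → E_q(2)` with `z ↦ v + a⁻¹ n` and `z̄ ↦ v⁻¹ + b⁻¹ n̄`. -/
def hyperboloidHom (q a b : k) : X q →ₐ[k] E q :=
  X.lift (fun
      | .z => E.gen q .v + a⁻¹ • E.gen q .n
      | .zbar => E.gen q .vinv + b⁻¹ • E.gen q .nbar)
    (by
      simp only [mul_add, add_mul, mul_smul_comm, smul_mul_assoc, E.v_mul_nbar, E.v_mul_vinv,
        E.vinv_mul_v, E.n_mul_nbar, E.n_mul_vinv, Algebra.algebraMap_eq_smul_one]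
      module)

theorem hyperboloidHom_z (q a b : k) :
    hyperboloidHom q a b (X.gen q .z) = E.gen q .v + a⁻¹ • E.gen q .n := X.lift_gen ..

theorem hyperboloidHom_zbar (q a b : k) :
    hyperboloidHom q a b (X.gen q .zbar) = E.gen q .vinv + b⁻¹ • E.gen q .nbar := X.lift_gen ..

/-- An element of `X_q` can be recovered from its image in `E_q(2)` by letting that image act on `1
⊗ c_0` in `hyperboloidAction`. -/
theorem hyperboloidHom_injective {a b : k} (hq : q ≠ 0) (ha : a ≠ 0) (hb : b ≠ 0) :
    Function.Injective (hyperboloidHom q a b) := by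
  -- Arbitrary `y`, rather than `y = 1`, makes this set closed under products.
  let S : Subalgebra k (X q) :=
    { carrier := {x | ∀ y : X q, ((hyperboloidAction a b hq).toEnd
        (hyperboloidHom q a b x)).unop (y ⊗ₜ CZ.c k 0) = (y * x) ⊗ₜ CZ.c k 0}
      mul_mem' := fun {x w} hx hw y => by
        simp only [Set.mem_ofPred_eq] at hx hw
        rw [map_mul, map_mul, MulOpposite.unop_mul, Module.End.mul_apply, hx, hw, mul_assoc]
      add_mem' := fun {x w} hx hw y => by
        simp only [Set.mem_ofPred_eq] at hx hw
        rw [map_add, map_add, MulOpposite.unop_add, LinearMap.add_apply, hx, hw, mul_add,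
          TensorProduct.add_tmul]
      algebraMap_mem' := fun r y => by
        rw [AlgHom.commutes, AlgHom.commutes, Algebra.algebraMap_eq_smul_one,
          Algebra.algebraMap_eq_smul_one, mul_smul_comm, mul_one]
        rfl }
  have hS : ∀ x : X q, x ∈ S := X.mem_of_gen_mem q fun g y => by
    cases g
    · rw [hyperboloidHom_z, hyperboloidAction_z a b hq ha]
    · rw [hyperboloidHom_zbar, hyperboloidAction_zbar a b hq hb]
  intro x w hxw
  have h : (1 * x) ⊗ₜ[k] CZ.c k 0 = (1 * w) ⊗ₜ[k] CZ.c k 0 :=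
    (hS x 1).symm.trans (hxw ▸ hS w 1)
  -- The coefficient at `c_0` recovers the element.
  simpa [CZ.c] using congrArg (fun t => TensorProduct.finsuppScalarRight k k (X q) ℤ t 0) h

end Entwining

/-! ### Homogeneous vectors and compatibility with the coalgebra -/

section Homogeneous

variable {k : Type*} [Field k] {Q : Type*} [AddCommGroup Q] [Module k Q]

/-- The subspace of all `u` with `φ (c_p ⊗ u) = u ⊗ c_r`. -/
def homogeneous (φ : CZ k ⊗[k] Q →ₗ[k] Q ⊗[k] CZ k) (p r : ℤ) : Submodule k Q :=
  LinearMap.eqLocus (φ ∘ₗ TensorProduct.mk k (CZ k) Q (CZ.c k p))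
    ((TensorProduct.mk k Q (CZ k)).flip (CZ.c k r))

theorem mem_homogeneous {φ : CZ k ⊗[k] Q →ₗ[k] Q ⊗[k] CZ k} {p r : ℤ} {u : Q} :
    u ∈ homogeneous φ p r ↔ φ (CZ.c k p ⊗ₜ u) = u ⊗ₜ CZ.c k r := Iff.rfl

/-- If `φ (c_p ⊗ u) = u ⊗ c_r`, both sides of the comultiplication identity are `u ⊗ c_r ⊗ c_r` and
both sides of the counit identity are `u`, because `c_p` and `c_r` are group-like. Linearity does
the rest. -/
theorem compatibleCoalg_of_iSup_homogeneous {φ : CZ k ⊗[k] Q →ₗ[k] Q ⊗[k] CZ k}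
    (h : ∀ p u, u ∈ ⨆ r, homogeneous φ p r) : CompatibleCoalg φ where
  comul := by
    refine CZ.tmul_hom_ext fun p u => ?_
    induction h p u using Submodule.iSup_induction' with
    | mem r x hx =>
      rw [mem_homogeneous] at hx
      simp [CZ.comul_c, hx]
    | zero => simp
    | add x y _ _ hx hy => rw [TensorProduct.tmul_add, map_add, map_add, hx, hy]
  counit := by
    refine CZ.tmul_hom_ext fun p u => ?_
    induction h p u using Submodule.iSup_induction' with
    | mem r x hx =>
      rw [mem_homogeneous] at hx
      simp [CZ.counit_c, hx]
    | zero => simp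
    | add x y _ _ hx hy => rw [TensorProduct.tmul_add, map_add, map_add, hx, hy]

end Homogeneous

/-! ### Uniqueness of the entwining map and the entwining data -/

section Entwining

variable {k : Type*} [Field k]

theorem CompatibleAlg.apply_mul {C P : Type*} [AddCommGroup C] [Module k C] [Ring P] [Algebra k P]
    {ψ : C ⊗[k] P →ₗ[k] P ⊗[k] C} (h : CompatibleAlg ψ) (c : C) (u w : P) :
    ψ (c ⊗ₜ (u * w)) = mulExt ψ (ψ (c ⊗ₜ u) ⊗ₜ w) := by
  simpa using LinearMap.congr_fun h.mul (c ⊗ₜ[k] (u ⊗ₜ[k] w))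

section Mul

variable {P : Type*} [Ring P] [Algebra k P] {ψ : CZ k ⊗[k] P →ₗ[k] P ⊗[k] CZ k}

/-- Homogeneous elements compose like arrows `p → r → t`: the left factor moves `c_p` to `c_r`, and
the right factor then starts from `c_r`. -/
theorem CompatibleAlg.mul_mem_homogeneous (h : CompatibleAlg ψ) {p r t : ℤ} {u w : P}
    (hu : u ∈ homogeneous ψ p r) (hw : w ∈ homogeneous ψ r t) : u * w ∈ homogeneous ψ p t := by
  rw [mem_homogeneous] at hu hw ⊢
  rw [h.apply_mul, hu, mulExt_tmul, hw, TensorProduct.smul_tmul', smul_eq_mul]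

theorem CompatibleAlg.one_mem_homogeneous (h : CompatibleAlg ψ) (p : ℤ) :
    1 ∈ homogeneous ψ p p := h.one _

end Mul

variable {q μ ν : k}

theorem CompatibleAlg.ext {ψ ψ' : CZ k ⊗[k] E q →ₗ[k] E q ⊗[k] CZ k}
    (h : CompatibleAlg ψ) (h' : CompatibleAlg ψ')
    (hg : ∀ p g, ψ (CZ.c k p ⊗ₜ E.gen q g) = ψ' (CZ.c k p ⊗ₜ E.gen q g)) : ψ = ψ' := by
  let S : Subalgebra k (E q) :=
    { carrier := {u | ∀ c, ψ (c ⊗ₜ u) = ψ' (c ⊗ₜ u)}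
      mul_mem' := fun {u w} hu hw c => by
        simp only [Set.mem_ofPred_eq] at hu hw
        rw [h.apply_mul, h'.apply_mul, hu]
        induction ψ' (c ⊗ₜ u) with
        | zero => simp
        | tmul x d => rw [mulExt_tmul, mulExt_tmul, hw]
        | add x y hx hy => rw [TensorProduct.add_tmul, map_add, map_add, hx, hy]
      add_mem' := fun {u w} hu hw c => by
        simp only [Set.mem_ofPred_eq] at hu hw
        rw [TensorProduct.tmul_add, map_add, map_add, hu, hw]
      algebraMap_mem' := fun r c => by
        rw [Algebra.algebraMap_eq_smul_one, TensorProduct.tmul_smul, map_smul, map_smul, h.one,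
          h'.one] }
  have hS : ∀ u : E q, u ∈ S := E.mem_of_gen_mem q fun g c => by
    have : ψ ∘ₗ (TensorProduct.mk k (CZ k) (E q)).flip (E.gen q g) =
        ψ' ∘ₗ (TensorProduct.mk k (CZ k) (E q)).flip (E.gen q g) :=
      CZ.hom_ext fun p => hg p g
    exact LinearMap.congr_fun this c
  exact TensorProduct.ext' fun c u => hS u c

theorem CompatibleAlg.ext_of_hasGenValues {ψ ψ' : CZ k ⊗[k] E q →ₗ[k] E q ⊗[k] CZ k}
    (h : CompatibleAlg ψ) (h' : CompatibleAlg ψ')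
    (hg : HasGenValues q μ ν ψ) (hg' : HasGenValues q μ ν ψ') : ψ = ψ' :=
  h.ext h' fun p g => by
    cases g
    · rw [hg.v, hg'.v]
    · rw [hg.vinv, hg'.vinv]
    · rw [hg.n, hg'.n]
    · rw [hg.nbar, hg'.nbar]

section

variable {ψ : CZ k ⊗[k] E q →ₗ[k] E q ⊗[k] CZ k}

/-- The added multiple of `v` cancels the `v`-terms in the prescribed value of `ψ` on `n`. -/
theorem HasGenValues.n_add_mem (hg : HasGenValues q μ ν ψ) (p : ℤ) :
    E.gen q .n + (μ * q ^ (2 * p)) • E.gen q .v ∈ homogeneous ψ p p := by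
  rw [mem_homogeneous, TensorProduct.tmul_add, TensorProduct.tmul_smul, map_add, map_smul, hg.n,
    hg.v, sub_add_cancel, TensorProduct.add_tmul, TensorProduct.smul_tmul']

theorem HasGenValues.nbar_add_mem (hg : HasGenValues q μ ν ψ) (p : ℤ) :
    E.gen q .nbar + (ν * q ^ (2 * p)) • E.gen q .vinv ∈ homogeneous ψ p p := by
  rw [mem_homogeneous, TensorProduct.tmul_add, TensorProduct.tmul_smul, map_add, map_smul, hg.nbar,
    hg.vinv, sub_add_cancel, TensorProduct.add_tmul, TensorProduct.smul_tmul']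

theorem HasGenValues.zpow_mem (hg : HasGenValues q μ ν ψ) (h : CompatibleAlg ψ) (p m : ℤ) :
    ((E.vUnit q ^ m : (E q)ˣ) : E q) ∈ homogeneous ψ p (p + m) := by
  induction m with
  | zero => simpa using h.one_mem_homogeneous p
  | succ i ih =>
    rw [zpow_add_one, Units.val_mul, ← add_assoc]
    exact h.mul_mem_homogeneous ih (hg.v _)
  | pred i ih =>
    rw [zpow_sub_one, Units.val_mul, ← add_sub_assoc]
    exact h.mul_mem_homogeneous ih (hg.vinv _)

theorem HasGenValues.mem_iSup_homogeneous (hg : HasGenValues q μ ν ψ) (h : CompatibleAlg ψ)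
    (p : ℤ) (u : E q) : u ∈ ⨆ r, homogeneous ψ p r := by
  have hle : ∀ p r, homogeneous ψ p r ≤ ⨆ r, homogeneous ψ p r := fun p r =>
    le_iSup (homogeneous ψ p) r
  -- The condition is imposed for all `p` at once: in a product the right factor must be decomposed
  -- at the index reached by the left factor.
  let S : Subalgebra k (E q) :=
    { carrier := {u | ∀ p, u ∈ ⨆ r, homogeneous ψ p r}
      mul_mem' := fun {u w} hu hw p => by
        replace hu := hu p
        induction hu using Submodule.iSup_induction' with
        | mem r x hx =>
          replace hw := hw r
          induction hw using Submodule.iSup_induction' with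
          | mem t y hy => exact hle _ _ (h.mul_mem_homogeneous hx hy)
          | zero => rw [mul_zero]; exact zero_mem _
          | add y z _ _ hy hz => rw [mul_add]; exact add_mem hy hz
        | zero => rw [zero_mul]; exact zero_mem _
        | add y z _ _ hy hz => rw [add_mul]; exact add_mem hy hz
      add_mem' := fun hu hw p => add_mem (hu p) (hw p)
      algebraMap_mem' := fun r p => by
        rw [Algebra.algebraMap_eq_smul_one]
        exact Submodule.smul_mem _ _ (hle _ _ (h.one_mem_homogeneous p)) }
  refine E.mem_of_gen_mem (S := S) q (fun g p => ?_) u p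
  have hv : E.gen q .v ∈ ⨆ r, homogeneous ψ p r := hle _ _ (hg.v p)
  have hvinv : E.gen q .vinv ∈ ⨆ r, homogeneous ψ p r := hle _ _ (hg.vinv p)
  cases g
  · exact hv
  · exact hvinv
  -- Here `n` is the difference of `n + μ q^{2p} v`, which fixes `c_p`, and a multiple of `v`, which
  -- shifts it.
  · simpa using sub_mem (hle _ _ (hg.n_add_mem p)) (Submodule.smul_mem _ (μ * q ^ (2 * p)) hv)
  · simpa using sub_mem (hle _ _ (hg.nbar_add_mem p)) (Submodule.smul_mem _ (ν * q ^ (2 * p)) hvinv)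

end

/-- The map `c_p ⊗ c_r ↦ c_r ⊗ c_{p+r-s}`. -/
def psiC (k : Type*) [Field k] (s : ℤ) : CZ k ⊗[k] CZ k →ₗ[k] CZ k ⊗[k] CZ k :=
  TensorProduct.lift (Finsupp.linearCombination k fun p : ℤ =>
    Finsupp.linearCombination k fun r : ℤ => CZ.c k r ⊗ₜ CZ.c k (p + r - s))

theorem psiC_tmul (s p r : ℤ) :
    psiC k s (CZ.c k p ⊗ₜ CZ.c k r) = CZ.c k r ⊗ₜ CZ.c k (p + r - s) := by
  simp [psiC, CZ.c]

theorem mem_span_c (c : CZ k) : c ∈ Submodule.span k (Set.range (CZ.c k)) := by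
  induction c using Finsupp.induction_linear with
  | zero => exact zero_mem _
  | add f g hf hg => exact add_mem hf hg
  | single p a =>
    have : Finsupp.single p a = a • CZ.c k p := by simp [CZ.c]
    rw [this]
    exact Submodule.smul_mem _ _ (Submodule.subset_span ⟨p, rfl⟩)

theorem psiC_compatibleCoalg (s : ℤ) : CompatibleCoalg (psiC k s) :=
  compatibleCoalg_of_iSup_homogeneous fun p c => by
    refine Submodule.span_le.2 ?_ (mem_span_c c)
    rintro _ ⟨r, rfl⟩
    exact le_iSup (homogeneous (psiC k s) p) (p + r - s) (psiC_tmul s p r)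

/-- The entwining data `(E_q(2), C, ψ, c_s, ψ^C)`. -/
def euclideanData (μ ν : k) (hq : q ≠ 0) (s : ℤ) : EntwiningData k (CZ k) (E q) where
  ψ := (entwiningAction μ ν hq).toEntwining
  ψ_alg := ActionData.toEntwining_compatibleAlg _
  ψ_coalg := compatibleCoalg_of_iSup_homogeneous
    ((hasGenValues_entwiningAction μ ν hq).mem_iSup_homogeneous
      (ActionData.toEntwining_compatibleAlg _))
  e := CZ.c k s
  e_groupLike := CZ.isGroupLikeElem s
  ψC := psiC k s
  ψC_coalg := psiC_compatibleCoalg s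
  ψC_e c := by
    have : psiC k s ∘ₗ TensorProduct.mk k (CZ k) (CZ k) (CZ.c k s) = Coalgebra.comul :=
      CZ.hom_ext fun p => by
        rw [CZ.comul_c, LinearMap.comp_apply, TensorProduct.mk_apply, psiC_tmul,
          add_sub_cancel_left]
    exact LinearMap.congr_fun this c

end Entwining

open EntwiningData

/-! ### The cleaving map, the cleft data and the comparison map `θ` -/

section Cleft

variable {k : Type*} [Field k] {q : k}

/-- The power `v ^ m` in `E_q(2)`. -/
def E.vpow (q : k) (m : ℤ) : E q := ((E.vUnit q ^ m : (E q)ˣ) : E q)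

theorem E.vpow_mul_vpow (m l : ℤ) : E.vpow q m * E.vpow q l = E.vpow q (m + l) := by
  rw [vpow, vpow, vpow, zpow_add, Units.val_mul]

theorem E.vpow_zero : E.vpow q 0 = 1 := by simp [vpow]

theorem E.vpow_one : E.vpow q 1 = E.gen q .v := by simp [vpow, vUnit]

theorem E.vpow_neg_one : E.vpow q (-1) = E.gen q .vinv := by simp [vpow, vUnit]

theorem E.vpow_mul_v (m : ℤ) : E.vpow q m * E.gen q .v = E.vpow q (m + 1) := by
  rw [← vpow_one, vpow_mul_vpow]

theorem E.vpow_mul_vinv (m : ℤ) : E.vpow q m * E.gen q .vinv = E.vpow q (m - 1) := by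
  rw [← vpow_neg_one, vpow_mul_vpow, sub_eq_add_neg]

theorem E.vpow_mul_n (hq : q ≠ 0) (m : ℤ) :
    E.vpow q m * E.gen q .n = q ^ (2 * m) • (E.gen q .n * E.vpow q m) :=
  E.zpow_mul hq E.v_mul_n m

theorem E.vpow_mul_nbar (hq : q ≠ 0) (m : ℤ) :
    E.vpow q m * E.gen q .nbar = q ^ (2 * m) • (E.gen q .nbar * E.vpow q m) :=
  E.zpow_mul hq E.v_mul_nbar m

theorem Phi_c (s p : ℤ) : Phi q s (CZ.c k p) = E.vpow q (p - s) := by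
  simp [Phi, CZ.c, E.vpow]

/-- The convolution inverse of `Φ`. -/
def PhiInv (q : k) (s : ℤ) : CZ k →ₗ[k] E q :=
  Finsupp.linearCombination k fun p : ℤ => E.vpow q (s - p)

theorem PhiInv_c (s p : ℤ) : PhiInv q s (CZ.c k p) = E.vpow q (s - p) := by
  simp [PhiInv, CZ.c]

/-- `Φ` as a unit of the convolution algebra. -/
def phiUnit (q : k) (s : ℤ) : (WithConv (CZ k →ₗ[k] E q))ˣ where
  val := WithConv.toConv (Phi q s)
  inv := WithConv.toConv (PhiInv q s)
  val_inv := by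
    apply WithConv.ofConv_injective
    refine CZ.hom_ext fun p => ?_
    simp [LinearMap.convMul_def, LinearMap.convOne_def, CZ.comul_c, CZ.counit_c, Phi_c, PhiInv_c,
      E.vpow_mul_vpow, E.vpow_zero]
  inv_val := by
    apply WithConv.ofConv_injective
    refine CZ.hom_ext fun p => ?_
    simp [LinearMap.convMul_def, LinearMap.convOne_def, CZ.comul_c, CZ.counit_c, Phi_c, PhiInv_c,
      E.vpow_mul_vpow, E.vpow_zero]

/-- The map `x ⊗ c ↦ x Φ (c)` on `P ⊗ C`. -/
def theta (q : k) (s : ℤ) : E q ⊗[k] CZ k →ₗ[k] E q :=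
  LinearMap.mul' k (E q) ∘ₗ (Phi q s).lTensor (E q)

theorem theta_tmul (s : ℤ) (x : E q) (c : CZ k) : theta q s (x ⊗ₜ c) = x * Phi q s c := rfl

theorem theta_smul (s : ℤ) (x : E q) (t : E q ⊗[k] CZ k) :
    theta q s (x • t) = x * theta q s t := by
  induction t with
  | zero => simp
  | tmul y c => rw [TensorProduct.smul_tmul', theta_tmul, theta_tmul, smul_eq_mul, mul_assoc]
  | add a b ha hb => rw [smul_add, map_add, map_add, mul_add, ha, hb]

variable {μ ν : k} {hq : q ≠ 0} {s : ℤ}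

local notation "𝓓" => euclideanData μ ν hq s

theorem euclideanData_hasGenValues : HasGenValues q μ ν (𝓓).ψ :=
  hasGenValues_entwiningAction μ ν hq

theorem vpow_mem (p r : ℤ) : E.vpow q (r - p) ∈ homogeneous (𝓓).ψ p r := by
  have := euclideanData_hasGenValues.zpow_mem (𝓓).ψ_alg p (r - p)
  rwa [add_sub_cancel] at this

theorem Phi_isCovariant : (𝓓).IsCovariant (Phi q s) := by
  refine CZ.tmul_c_hom_ext fun p r => ?_
  have h := vpow_mem (μ := μ) (ν := ν) (hq := hq) (s := s) p (p + r - s)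
  have e : p + r - s - p = r - s := by ring
  rw [e, mem_homogeneous] at h
  have h' : (𝓓).ψC (CZ.c k p ⊗ₜ CZ.c k r) = _ := psiC_tmul s p r
  simp [Phi_c, h, h']

variable (μ ν hq s) in
/-- The map `ρ` of the cleft extension. -/
def rho : CZ k ⊗[k] E q →ₗ[k] E q :=
  (𝓓).cleftRho (Phi q s) (PhiInv q s)

local notation "𝝆" => rho μ ν hq s

/-- On homogeneous elements `ρ` is multiplication by powers of `v` on both sides. The three factors
lie in `P_{s,p}`, `P_{p,r}` and `P_{r,s}`, so the result lies in `P_{s,s} = M`. -/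
theorem rho_of_mem {p r : ℤ} {u : E q} (hu : u ∈ homogeneous (𝓓).ψ p r) :
    𝝆 (CZ.c k p ⊗ₜ u) = E.vpow q (p - s) * u * E.vpow q (s - r) := by
  rw [mem_homogeneous] at hu
  simp [rho, cleftRho, CZ.comul_c, hu, Phi_c, PhiInv_c, mul_assoc]

theorem rho_mem_of_mem {p r : ℤ} {u : E q} (hu : u ∈ homogeneous (𝓓).ψ p r) :
    𝝆 (CZ.c k p ⊗ₜ u) ∈ (𝓓).M := by
  rw [rho_of_mem hu]
  exact (𝓓).ψ_alg.mul_mem_homogeneous ((𝓓).ψ_alg.mul_mem_homogeneous (vpow_mem s p) hu)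
    (vpow_mem r s)

theorem rhoHat_of_mem {p r : ℤ} {u : E q} (hu : u ∈ homogeneous (𝓓).ψ p r) :
    (𝓓).rhoHat 𝝆 (CZ.c k p ⊗ₜ u) = 𝝆 (CZ.c k p ⊗ₜ u) ⊗ₜ CZ.c k r := by
  rw [mem_homogeneous] at hu
  simp [rhoHat, hat, CZ.comul_c, hu]

/-- Reduces statements linear in `c` and `u` to a basis vector `c_p` and an element `u` homogeneous
for that particular `p`. -/
theorem induction_homogeneous {motive : CZ k → E q → Prop}
    (mem : ∀ p r u, u ∈ homogeneous (𝓓).ψ p r → motive (CZ.c k p) u)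
    (zero_left : ∀ u, motive 0 u) (zero_right : ∀ c, motive c 0)
    (add_left : ∀ c d u, motive c u → motive d u → motive (c + d) u)
    (smul_left : ∀ (a : k) c u, motive c u → motive (a • c) u)
    (add_right : ∀ c u w, motive c u → motive c w → motive c (u + w)) (c : CZ k) (u : E q) :
    motive c u := by
  induction mem_span_c c using Submodule.span_induction with
  | mem x hx =>
    obtain ⟨p, rfl⟩ := hx
    have hu := euclideanData_hasGenValues.mem_iSup_homogeneous (𝓓).ψ_alg p u
    induction hu using Submodule.iSup_induction' with
    | mem r x hx => exact mem p r x hx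
    | zero => exact zero_right _
    | add x y _ _ hx hy => exact add_right _ _ _ hx hy
  | zero => exact zero_left u
  | add x y _ _ hx hy => exact add_left _ _ _ hx hy
  | smul a x _ hx => exact smul_left _ _ _ hx

theorem rhoHat_mem (c : CZ k) (u : E q) :
    (𝓓).rhoHat 𝝆 (c ⊗ₜ u) ∈ LinearMap.range (𝓓).incl := by
  induction c, u using induction_homogeneous (μ := μ) (ν := ν) (hq := hq) (s := s) with
  | mem p r u hu =>
    rw [rhoHat_of_mem hu]
    exact ⟨⟨_, rho_mem_of_mem hu⟩ ⊗ₜ _, rfl⟩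
  | zero_left u => simp
  | zero_right c => simp
  | add_left c d u hc hd => rw [TensorProduct.add_tmul, map_add]; exact add_mem hc hd
  | smul_left a c u hc =>
    rw [← TensorProduct.smul_tmul', map_smul]; exact Submodule.smul_mem _ _ hc
  | add_right c u w hu hw => rw [TensorProduct.tmul_add, map_add]; exact add_mem hu hw

/-- The factor `Φ⁻¹` in `ρ` is cancelled by the `Φ` in `θ`. -/
theorem theta_rhoHat (c : CZ k) (u : E q) :
    theta q s ((𝓓).rhoHat 𝝆 (c ⊗ₜ u)) = Phi q s c * u := by
  induction c, u using induction_homogeneous (μ := μ) (ν := ν) (hq := hq) (s := s) with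
  | mem p r u hu =>
    rw [rhoHat_of_mem hu, theta_tmul, rho_of_mem hu, Phi_c, Phi_c, mul_assoc, E.vpow_mul_vpow,
      sub_add_sub_cancel, sub_self, E.vpow_zero, mul_one]
  | zero_left u => simp
  | zero_right c => simp
  | add_left c d u hc hd => rw [TensorProduct.add_tmul, map_add, map_add, hc, hd, map_add, add_mul]
  | smul_left a c u hc =>
    rw [← TensorProduct.smul_tmul', map_smul, map_smul, hc, map_smul, smul_mul_assoc]
  | add_right c u w hu hw => rw [TensorProduct.tmul_add, map_add, map_add, hu, hw, mul_add]

variable (μ ν hq s) in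
/-- The trivial cocycle. -/
def sigma : CZ k ⊗[k] CZ k →ₗ[k] (𝓓).M :=
  Algebra.linearMap k (𝓓).M ∘ₗ LinearMap.mul' k k ∘ₗ
    TensorProduct.map Coalgebra.counit Coalgebra.counit

local notation "𝝈" => sigma μ ν hq s

theorem sigma_tmul (p r : ℤ) : 𝝈 (CZ.c k p ⊗ₜ CZ.c k r) = 1 := by
  simp [sigma, CZ.counit_c]

theorem psiC_c (p r : ℤ) :
    (𝓓).ψC (CZ.c k p ⊗ₜ CZ.c k r) = CZ.c k r ⊗ₜ CZ.c k (p + r - s) := psiC_tmul s p r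

theorem val_comp_sigma :
    (𝓓).M.val.toLinearMap ∘ₗ 𝝈 = (𝓓).cleftSigma (Phi q s) (PhiInv q s) := by
  refine CZ.tmul_c_hom_ext fun p r => ?_
  have e : p - s + (r - (p + r - s)) = 0 := by ring
  simp [cleftSigma, CZ.comul_c, psiC_c, Phi_c, PhiInv_c, E.vpow_mul_vpow, e, E.vpow_zero,
    sigma_tmul]

theorem sigmaHat_c (p r : ℤ) :
    (𝓓).sigmaHat 𝝈 (CZ.c k p ⊗ₜ CZ.c k r) = 1 ⊗ₜ CZ.c k (p + r - s) := by
  simp [sigmaHat, hat, CZ.comul_c, psiC_c, sigma_tmul]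

theorem theta_sigmaHat (b c : CZ k) :
    theta q s ((𝓓).sigmaHat 𝝈 (b ⊗ₜ c)) = Phi q s b * Phi q s c := by
  have : theta q s ∘ₗ (𝓓).sigmaHat 𝝈 =
      LinearMap.mul' k (E q) ∘ₗ TensorProduct.map (Phi q s) (Phi q s) :=
    CZ.tmul_c_hom_ext fun p r => by
      have e : p + r - s - s = p - s + (r - s) := by ring
      simp [sigmaHat_c, theta_tmul, Phi_c, E.vpow_mul_vpow, e]
  exact LinearMap.congr_fun this (b ⊗ₜ c)

theorem theta_mulExt_rhoHat (t : E q ⊗[k] CZ k) (u : E q) :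
    theta q s (mulExt ((𝓓).rhoHat 𝝆) (t ⊗ₜ u)) = theta q s t * u := by
  induction t with
  | zero => simp
  | tmul x c => rw [mulExt_tmul, theta_smul, theta_rhoHat, theta_tmul, mul_assoc]
  | add a b ha hb => rw [TensorProduct.add_tmul, map_add, map_add, map_add, ha, hb, add_mul]

theorem theta_mulExt_sigmaHat (t : E q ⊗[k] CZ k) (c : CZ k) :
    theta q s (mulExt ((𝓓).sigmaHat 𝝈) (t ⊗ₜ c)) = theta q s t * Phi q s c := by
  induction t with
  | zero => simp
  | tmul x c => rw [mulExt_tmul, theta_smul, theta_sigmaHat, theta_tmul, mul_assoc]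
  | add a b ha hb => rw [TensorProduct.add_tmul, map_add, map_add, map_add, ha, hb, add_mul]

/-- This holds on all of `P ⊗ C`, before the crossed product conditions are known, and is what those
conditions are derived from. -/
theorem theta_mulFormula (t w : E q ⊗[k] CZ k) :
    theta q s ((𝓓).mulFormula 𝝆 𝝈 (t ⊗ₜ w)) = theta q s t * theta q s w := by
  induction w with
  | zero => simp
  | tmul x c =>
    rw [mulFormula_tmul, theta_mulExt_sigmaHat, theta_mulExt_rhoHat, theta_tmul, mul_assoc]
  | add a b ha hb => rw [TensorProduct.tmul_add, map_add, map_add, map_add, ha, hb, mul_add]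

theorem mulExt_rhoHat_mem {t : E q ⊗[k] CZ k} (ht : t ∈ LinearMap.range (𝓓).incl) (u : E q) :
    mulExt ((𝓓).rhoHat 𝝆) (t ⊗ₜ u) ∈ LinearMap.range (𝓓).incl := by
  obtain ⟨w, rfl⟩ := ht
  induction w with
  | zero => simp
  | tmul a b =>
    rw [incl_tmul, mulExt_tmul]
    exact smul_mem_range a.2 (rhoHat_mem b u)
  | add a b ha hb =>
    rw [map_add, TensorProduct.add_tmul, map_add]
    exact add_mem ha hb

theorem mulFormula_mem {t : E q ⊗[k] CZ k} (ht : t ∈ LinearMap.range (𝓓).incl)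
    (w : E q ⊗[k] CZ k) : (𝓓).mulFormula 𝝆 𝝈 (t ⊗ₜ w) ∈ LinearMap.range (𝓓).incl := by
  induction w with
  | zero => simp
  | tmul x c =>
    rw [mulFormula_tmul]
    exact mulExt_sigmaHat_mem (mulExt_rhoHat_mem ht x) c
  | add a b ha hb =>
    rw [TensorProduct.tmul_add, map_add]
    exact add_mem ha hb

/-! ### Bijectivity of `θ` and the crossed product conditions -/

/-- An explicit left inverse of `θ` on `M ⊗ C`: `ψ (c_s ⊗ -)` sends `x v^{r-s}` to `x v^{r-s} ⊗
c_r`, which records the index `r`, and the endomorphism then strips off `v^{r-s}`. -/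
theorem freeEnd_psi_theta (t : (𝓓).M ⊗[k] CZ k) :
    freeEnd (fun r => E.vpow q (s - r) ⊗ₜ[k] CZ.c k r)
      ((𝓓).ψ (CZ.c k s ⊗ₜ theta q s ((𝓓).incl t))) = (𝓓).incl t := by
  induction t with
  | zero => simp
  | add a b ha hb =>
    simp only [map_add, TensorProduct.tmul_add, ha, hb]
  | tmul x c =>
    induction mem_span_c c using Submodule.span_induction with
    | mem c hc =>
      obtain ⟨r, rfl⟩ := hc
      have h : (x : E q) * E.vpow q (r - s) ∈ homogeneous (𝓓).ψ s r :=
        (𝓓).ψ_alg.mul_mem_homogeneous x.2 (vpow_mem s r)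
      rw [mem_homogeneous] at h
      rw [incl_tmul, theta_tmul, Phi_c, h, freeEnd_tmul, TensorProduct.smul_tmul', smul_eq_mul,
        mul_assoc, E.vpow_mul_vpow, sub_add_sub_cancel, sub_self, E.vpow_zero, mul_one]
    | zero => simp
    | add c d _ _ hc hd => simp only [map_add, TensorProduct.tmul_add, hc, hd]
    | smul a c _ hc =>
      simp only [map_smul, TensorProduct.tmul_smul, LinearMap.map_smul_of_tower, hc]

theorem theta_comp_incl_injective : Function.Injective (theta q s ∘ₗ (𝓓).incl) := fun t w h => by
  apply (𝓓).incl_injective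
  rw [← freeEnd_psi_theta t, ← freeEnd_psi_theta w]
  exact congrArg (fun x => freeEnd _ ((𝓓).ψ (CZ.c k s ⊗ₜ x))) h

theorem theta_comp_incl_surjective : Function.Surjective (theta q s ∘ₗ (𝓓).incl) := by
  rw [← LinearMap.range_eq_top, eq_top_iff]
  intro u _
  have hu := euclideanData_hasGenValues.mem_iSup_homogeneous (𝓓).ψ_alg s u
  induction hu using Submodule.iSup_induction' with
  | mem r x hx =>
    -- Multiplying `x ∈ P_{s,r}` by `v^{s-r} ∈ P_{r,s}` brings it into `P_{s,s} = M`.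
    refine ⟨⟨x * E.vpow q (s - r), (𝓓).ψ_alg.mul_mem_homogeneous hx (vpow_mem r s)⟩ ⊗ₜ CZ.c k r, ?_⟩
    rw [LinearMap.comp_apply, incl_tmul, theta_tmul, Phi_c, mul_assoc, E.vpow_mul_vpow,
      sub_add_sub_cancel, sub_self, E.vpow_zero, mul_one]
  | zero => exact zero_mem _
  | add x y _ _ hx hy => exact add_mem (hx trivial) (hy trivial)

theorem eq_of_theta_eq {t w : E q ⊗[k] CZ k} (ht : t ∈ LinearMap.range (𝓓).incl)
    (hw : w ∈ LinearMap.range (𝓓).incl) (h : theta q s t = theta q s w) : t = w := by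
  obtain ⟨t, rfl⟩ := ht
  obtain ⟨w, rfl⟩ := hw
  rw [theta_comp_incl_injective h]

theorem isCrossedProductData : (𝓓).IsCrossedProductData 𝝆 𝝈 where
  rho_e x hx := by
    have h : 𝝆 (CZ.c k s ⊗ₜ x) = _ := rho_of_mem hx
    rw [sub_self, E.vpow_zero, one_mul, mul_one] at h
    exact h
  rho_one c := by
    have : 𝝆 ∘ₗ (TensorProduct.mk k (CZ k) (E q)).flip 1 =
        Algebra.linearMap k (E q) ∘ₗ Coalgebra.counit := CZ.hom_ext fun p => by
      have h : 𝝆 (CZ.c k p ⊗ₜ 1) = _ := rho_of_mem ((𝓓).ψ_alg.one_mem_homogeneous p)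
      simpa [CZ.counit_c, E.vpow_mul_vpow, E.vpow_zero] using h
    exact LinearMap.congr_fun this c
  rho_mem c x _ := rhoHat_mem c x
  rho_mul c x _ y _ := eq_of_theta_eq (rhoHat_mem c _) (mulExt_rhoHat_mem (rhoHat_mem c x) y) <| by
    rw [theta_rhoHat, theta_mulExt_rhoHat, theta_rhoHat, mul_assoc]
  sigma_e c := by
    have : 𝝈 ∘ₗ TensorProduct.mk k (CZ k) (CZ k) (CZ.c k s) =
        Algebra.linearMap k (𝓓).M ∘ₗ Coalgebra.counit := CZ.hom_ext fun p => by
      simp [CZ.counit_c, sigma_tmul]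
    exact LinearMap.congr_fun this c
  sigma_hat_e c := by
    have : (𝓓).sigmaHat 𝝈 ∘ₗ (TensorProduct.mk k (CZ k) (CZ k)).flip (CZ.c k s) =
        TensorProduct.mk k (E q) (CZ k) 1 := CZ.hom_ext fun p => by
      simp [sigmaHat_c]
    exact LinearMap.congr_fun this c
  cocycle a b c := by
    -- The left side is the product of `1 ⊗ a` with `σ̂ (b ⊗ c)`; under `θ` both sides become `Φ(a)
    -- Φ(b) Φ(c)`.
    rw [← mulFormula_one_tmul]
    refine eq_of_theta_eq (mulFormula_mem ⟨1 ⊗ₜ a, rfl⟩ _)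
      (mulExt_sigmaHat_mem (sigmaHat_mem a b) c) ?_
    rw [theta_mulFormula, theta_mulExt_sigmaHat, theta_sigmaHat, theta_sigmaHat, theta_tmul,
      one_mul, mul_assoc]
  twisted_module a b x _ := by
    -- In the same way both sides become `Φ(a) Φ(b) x`.
    rw [← mulFormula_one_tmul]
    refine eq_of_theta_eq (mulFormula_mem ⟨1 ⊗ₜ a, rfl⟩ _)
      (mulExt_rhoHat_mem (sigmaHat_mem a b) x) ?_
    rw [theta_mulFormula, theta_mulExt_rhoHat, theta_sigmaHat, theta_rhoHat, theta_tmul,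
      one_mul, mul_assoc]

theorem Phi_e : Phi q s (CZ.c k s) = 1 := by rw [Phi_c, sub_self, E.vpow_zero]

variable (μ ν hq s) in
/-- The algebra isomorphism `x ⊗ c ↦ x Φ (c)` from the crossed product to `E_q(2)`. -/
def crossedProductEquiv :
    CrossedProduct (isCrossedProductData (μ := μ) (ν := ν) (hq := hq) (s := s)) ≃ₐ[k] E q :=
  AlgEquiv.ofBijective
    (AlgHom.ofLinearMap ((theta q s ∘ₗ (𝓓).incl) ∘ₗ (CrossedProduct.of _).symm.toLinearMap)
      (by
        rw [CrossedProduct.one_eq]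
        change theta q s (1 ⊗ₜ CZ.c k s) = 1
        rw [theta_tmul, Phi_e, one_mul])
      (fun x y => by
        obtain ⟨x, rfl⟩ := (CrossedProduct.of _).surjective x
        obtain ⟨y, rfl⟩ := (CrossedProduct.of _).surjective y
        rw [CrossedProduct.of_mul_of]
        simp only [LinearMap.comp_apply, LinearEquiv.coe_coe, LinearEquiv.symm_apply_apply]
        rw [incl_crossedMul, theta_mulFormula]))
    (Function.Bijective.comp ⟨theta_comp_incl_injective, theta_comp_incl_surjective⟩
      (CrossedProduct.of _).symm.bijective)

theorem crossedProductEquiv_of (x : (𝓓).M) (c : CZ k) :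
    crossedProductEquiv μ ν hq s (CrossedProduct.of _ (x ⊗ₜ c)) = (x : E q) * Phi q s c := rfl

/-! ### Values of `ρ` on the generators -/

theorem rho_v (p : ℤ) : 𝝆 (CZ.c k p ⊗ₜ E.gen q .v) = 1 := by
  have h := rho_of_mem (s := s)
    (euclideanData_hasGenValues (μ := μ) (ν := ν) (hq := hq) (s := s)|>.v p)
  rw [h, E.vpow_mul_v, E.vpow_mul_vpow]
  convert E.vpow_zero using 2
  ring

theorem rho_vinv (p : ℤ) : 𝝆 (CZ.c k p ⊗ₜ E.gen q .vinv) = 1 := by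
  have h := rho_of_mem (s := s)
    (euclideanData_hasGenValues (μ := μ) (ν := ν) (hq := hq) (s := s)|>.vinv p)
  rw [h, E.vpow_mul_vinv, E.vpow_mul_vpow]
  convert E.vpow_zero using 2
  ring

theorem rho_n (p : ℤ) : 𝝆 (CZ.c k p ⊗ₜ E.gen q .n) =
    q ^ (2 * p) • (q ^ (-2 * s) • E.gen q .n + μ • (E.gen q .v - 1)) := by
  have h := rho_of_mem (s := s)
    (euclideanData_hasGenValues (μ := μ) (ν := ν) (hq := hq) (s := s)|>.n_add_mem p)
  have e : p - s + 1 + (s - p) = 1 := by ring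
  have e' : q ^ (2 * (p - s)) = q ^ (2 * p) * q ^ (-2 * s) := by
    rw [← zpow_add₀ hq]; congr 1; ring
  -- As `n` itself is not homogeneous, `ρ` is evaluated on `n + μ q^{2p} v` and the contribution `μ
  -- q^{2p}` of `v` is subtracted.
  rw [TensorProduct.tmul_add, TensorProduct.tmul_smul, map_add, map_smul, rho_v,
    ← eq_sub_iff_add_eq] at h
  rw [h, mul_add, add_mul, mul_smul_comm, E.vpow_mul_n hq, E.vpow_mul_v, smul_mul_assoc,
    smul_mul_assoc, mul_assoc, E.vpow_mul_vpow, E.vpow_mul_vpow, e, E.vpow_one,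
    sub_add_sub_cancel, sub_self, E.vpow_zero, mul_one, e']
  module

theorem rho_nbar (p : ℤ) : 𝝆 (CZ.c k p ⊗ₜ E.gen q .nbar) =
    q ^ (2 * p) • (q ^ (-2 * s) • E.gen q .nbar + ν • (E.gen q .vinv - 1)) := by
  have h := rho_of_mem (s := s)
    (euclideanData_hasGenValues (μ := μ) (ν := ν) (hq := hq) (s := s)|>.nbar_add_mem p)
  have e : p - s - 1 + (s - p) = -1 := by ring
  have e' : q ^ (2 * (p - s)) = q ^ (2 * p) * q ^ (-2 * s) := by
    rw [← zpow_add₀ hq]; congr 1; ring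
  rw [TensorProduct.tmul_add, TensorProduct.tmul_smul, map_add, map_smul, rho_vinv,
    ← eq_sub_iff_add_eq] at h
  rw [h, mul_add, add_mul, mul_smul_comm, E.vpow_mul_nbar hq, E.vpow_mul_vinv, smul_mul_assoc,
    smul_mul_assoc, mul_assoc, E.vpow_mul_vpow, E.vpow_mul_vpow, e, E.vpow_neg_one,
    sub_add_sub_cancel, sub_self, E.vpow_zero, mul_one, e']
  module

/-! ### The hyperboloid as the fixed point subalgebra -/

theorem hyperboloidHom_mem (hμ : μ ≠ 0) (hν : ν ≠ 0) (x : X q) :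
    hyperboloidHom q (μ * q ^ (2 * s)) (ν * q ^ (2 * s)) x ∈ (𝓓).M := by
  have hqs : q ^ (2 * s) ≠ 0 := zpow_ne_zero _ hq
  refine X.mem_of_gen_mem q (S := (𝓓).M.comap (hyperboloidHom q _ _)) (fun g => ?_) x
  change hyperboloidHom q _ _ (X.gen q g) ∈ homogeneous (𝓓).ψ s s
  cases g
  · have h := Submodule.smul_mem _ (μ * q ^ (2 * s))⁻¹
      (euclideanData_hasGenValues (μ := μ) (ν := ν) (hq := hq) (s := s)|>.n_add_mem s)
    rwa [smul_add, inv_smul_smul₀ (mul_ne_zero hμ hqs), add_comm, ← hyperboloidHom_z] at h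
  · have h := Submodule.smul_mem _ (ν * q ^ (2 * s))⁻¹
      (euclideanData_hasGenValues (μ := μ) (ν := ν) (hq := hq) (s := s)|>.nbar_add_mem s)
    rwa [smul_add, inv_smul_smul₀ (mul_ne_zero hν hqs), add_comm, ← hyperboloidHom_zbar] at h

/-- The span contains `1` and is stable under right multiplication by the generators: `v^{±1}`
shifts the power, and `n = a (z - v)`, `n̄ = b (z̄ - v⁻¹)` can be moved to the left past `v^r` at
the cost of a scalar. -/
theorem mem_span_hyperboloid_mul_vpow {a b : k} (hq : q ≠ 0) (ha : a ≠ 0) (hb : b ≠ 0) (u : E q) :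
    u ∈ Submodule.span k
      (Set.range fun x : X q × ℤ => hyperboloidHom q a b x.1 * E.vpow q x.2) := by
  set W := Submodule.span k
    (Set.range fun x : X q × ℤ => hyperboloidHom q a b x.1 * E.vpow q x.2) with hW
  have base : ∀ y r, hyperboloidHom q a b y * E.vpow q r ∈ W := fun y r =>
    Submodule.subset_span ⟨(y, r), rfl⟩
  let S : Subalgebra k (E q) :=
    { carrier := {u | ∀ w ∈ W, w * u ∈ W}
      mul_mem' := fun {u u'} hu hu' w hw => by
        rw [← mul_assoc]
        exact hu' _ (hu _ hw)
      add_mem' := fun {u u'} hu hu' w hw => by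
        rw [mul_add]
        exact add_mem (hu _ hw) (hu' _ hw)
      algebraMap_mem' := fun r w hw => by
        rw [Algebra.algebraMap_eq_smul_one, mul_smul_comm, mul_one]
        exact Submodule.smul_mem _ _ hw }
  have hS : ∀ g, E.gen q g ∈ S := fun g w hw => by
    induction hw using Submodule.span_induction with
    | mem w hw =>
      obtain ⟨⟨y, r⟩, rfl⟩ := hw
      change hyperboloidHom q a b y * E.vpow q r * E.gen q g ∈ W
      cases g
      · rw [mul_assoc, E.vpow_mul_v]
        exact base _ _
      · rw [mul_assoc, E.vpow_mul_vinv]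
        exact base _ _
      · have e : E.gen q .n * E.vpow q r = a • (hyperboloidHom q a b (X.gen q .z) * E.vpow q r -
            E.vpow q (r + 1)) := by
          rw [hyperboloidHom_z, add_mul, ← E.vpow_one, E.vpow_mul_vpow, add_comm 1 r,
            add_sub_cancel_left, smul_mul_assoc, smul_inv_smul₀ ha]
        rw [mul_assoc, E.vpow_mul_n hq, e, mul_smul_comm, mul_smul_comm, mul_sub, ← mul_assoc,
          ← map_mul]
        exact Submodule.smul_mem _ _ (Submodule.smul_mem _ _ (sub_mem (base _ _) (base _ _)))
      · have e : E.gen q .nbar * E.vpow q r =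
            b • (hyperboloidHom q a b (X.gen q .zbar) * E.vpow q r - E.vpow q (-1 + r)) := by
          rw [hyperboloidHom_zbar, add_mul, ← E.vpow_neg_one, E.vpow_mul_vpow,
            add_sub_cancel_left, smul_mul_assoc, smul_inv_smul₀ hb]
        rw [mul_assoc, E.vpow_mul_nbar hq, e, mul_smul_comm, mul_smul_comm, mul_sub, ← mul_assoc,
          ← map_mul]
        exact Submodule.smul_mem _ _ (Submodule.smul_mem _ _ (sub_mem (base _ _) (base _ _)))
    | zero => rw [zero_mul]; exact zero_mem _
    | add x y _ _ hx hy => rw [add_mul]; exact add_mem hx hy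
    | smul c x _ hx => rw [smul_mul_assoc]; exact Submodule.smul_mem _ _ hx
  have h1 : (1 : E q) ∈ W := by simpa [E.vpow_zero] using base 1 0
  simpa using E.mem_of_gen_mem q hS u 1 h1

/-- Expanding `x ∈ M` in elements of `f(X_q)` times powers of `v` gives a preimage of `x` under `θ`
in `f(X_q) ⊗ C`. Another preimage is `x ⊗ c_s`; injectivity of `θ` equates them, so `x` is a
`c_s`-coefficient with values in `f(X_q)`. -/
theorem hyperboloidHom_surjective (hμ : μ ≠ 0) (hν : ν ≠ 0) {x : E q} (hx : x ∈ (𝓓).M) :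
    ∃ y, hyperboloidHom q (μ * q ^ (2 * s)) (ν * q ^ (2 * s)) y = x := by
  have hqs : q ^ (2 * s) ≠ 0 := zpow_ne_zero _ hq
  set f := hyperboloidHom q (μ * q ^ (2 * s)) (ν * q ^ (2 * s)) with hf
  have hmem : ∀ y, f y ∈ (𝓓).M := hyperboloidHom_mem hμ hν
  have hW : x ∈ LinearMap.range (theta q s ∘ₗ f.toLinearMap.rTensor (CZ k)) := by
    refine Submodule.span_le.2 ?_ (mem_span_hyperboloid_mul_vpow hq (mul_ne_zero hμ hqs)
      (mul_ne_zero hν hqs) x)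
    rintro _ ⟨⟨y, r⟩, rfl⟩
    -- The shift by `s` is there because `Φ(c_{r+s}) = v^r`.
    refine ⟨y ⊗ₜ CZ.c k (r + s), ?_⟩
    simp [theta_tmul, Phi_c, hf]
  obtain ⟨t, ht⟩ := hW
  have hrange : ∀ t, f.toLinearMap.rTensor (CZ k) t ∈ LinearMap.range (𝓓).incl := fun t => by
    induction t with
    | zero => simp
    | tmul y c => exact ⟨⟨f y, hmem y⟩ ⊗ₜ c, rfl⟩
    | add a b ha hb => rw [map_add]; exact add_mem ha hb
  have key : f.toLinearMap.rTensor (CZ k) t = x ⊗ₜ CZ.c k s :=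
    eq_of_theta_eq (hrange t) ⟨⟨x, hx⟩ ⊗ₜ CZ.c k s, rfl⟩ (by
      rw [theta_tmul, Phi_e, mul_one]
      exact ht)
  -- Taking the coefficient at `c_s` commutes with applying `f` to the left tensor factor.
  have coeff : ∀ t : X q ⊗[k] CZ k,
      TensorProduct.finsuppScalarRight k k (E q) ℤ (f.toLinearMap.rTensor (CZ k) t) s =
        f (TensorProduct.finsuppScalarRight k k (X q) ℤ t s) := fun t => by
    induction t with
    | zero => simp
    | tmul y c => simp
    | add a b ha hb => simp only [map_add, Finsupp.add_apply, ha, hb]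
  refine ⟨TensorProduct.finsuppScalarRight k k (X q) ℤ t s, ?_⟩
  rw [← coeff, key]
  simp [CZ.c]

variable (hq s) in
/-- The isomorphism of the quantum hyperboloid with the fixed point subalgebra. -/
def hyperboloidEquiv (hμ : μ ≠ 0) (hν : ν ≠ 0) : X q ≃ₐ[k] (𝓓).M :=
  AlgEquiv.ofBijective
    ((hyperboloidHom q (μ * q ^ (2 * s)) (ν * q ^ (2 * s))).codRestrict (𝓓).M
      (hyperboloidHom_mem hμ hν))
    ⟨fun _ _ h => hyperboloidHom_injective hq (mul_ne_zero hμ (zpow_ne_zero _ hq))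
      (mul_ne_zero hν (zpow_ne_zero _ hq)) (congrArg Subtype.val h),
    fun x => by
      obtain ⟨y, hy⟩ := hyperboloidHom_surjective hμ hν x.2
      exact ⟨y, Subtype.ext hy⟩⟩

theorem hyperboloidEquiv_apply (hμ : μ ≠ 0) (hν : ν ≠ 0) (x : X q) :
    (hyperboloidEquiv hq s hμ hν x : E q) =
      hyperboloidHom q (μ * q ^ (2 * s)) (ν * q ^ (2 * s)) x := rfl

end Cleft

end CoalgCrossed

end

theorem mainTheorem6 {k : Type*} [Field k] (q μ ν : k) (hq : q ≠ 0) (hμ : μ ≠ 0) (hν : ν ≠ 0)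
    (s : ℤ) :
    -- the values on the generators extend uniquely to a map compatible with the product
    (∃! ψ : CZ k ⊗[k] E q →ₗ[k] E q ⊗[k] CZ k, CompatibleAlg ψ ∧ HasGenValues q μ ν ψ) ∧
    -- the entwining data `(E_q(2), C, ψ, c_s, ψ^C)`
    ∃ D : EntwiningData k (CZ k) (E q),
      HasGenValues q μ ν D.ψ ∧
      D.e = CZ.c k s ∧
      (∀ p r : ℤ, D.ψC (CZ.c k p ⊗ₜ CZ.c k r) = CZ.c k r ⊗ₜ CZ.c k (p + r - s)) ∧
      -- the fixed point subalgebra is the quantum hyperboloid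
      ∃ ι : X q ≃ₐ[k] D.M,
        ((ι (X.gen q .z) : D.M) : E q) = E.gen q .v + (μ⁻¹ * q ^ (-2 * s)) • E.gen q .n ∧
        ((ι (X.gen q .zbar) : D.M) : E q) =
          E.gen q .vinv + (ν⁻¹ * q ^ (-2 * s)) • E.gen q .nbar ∧
        -- `Φ` is unital, covariant and convolution invertible
        Phi q s D.e = 1 ∧
        D.IsCovariant (Phi q s) ∧
        ∃ Φ : (WithConv (CZ k →ₗ[k] E q))ˣ,
          (Φ : WithConv (CZ k →ₗ[k] E q)) = WithConv.toConv (Phi q s) ∧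
          -- the cleft extension data defined by `Φ`: explicit `ρ` and trivial `σ`
          ∃ (ρ : CZ k ⊗[k] E q →ₗ[k] E q) (σ : CZ k ⊗[k] CZ k →ₗ[k] D.M),
            ρ = D.cleftRho (Phi q s) (Φ⁻¹).val.ofConv ∧
            D.M.val.toLinearMap ∘ₗ σ = D.cleftSigma (Phi q s) (Φ⁻¹).val.ofConv ∧
            (∀ p r : ℤ, σ (CZ.c k p ⊗ₜ CZ.c k r) = 1) ∧
            (∀ p : ℤ, ρ (CZ.c k p ⊗ₜ E.gen q .v) = 1) ∧
            (∀ p : ℤ, ρ (CZ.c k p ⊗ₜ E.gen q .vinv) = 1) ∧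
            (∀ p : ℤ, ρ (CZ.c k p ⊗ₜ E.gen q .n) =
              q ^ (2 * p) • (q ^ (-2 * s) • E.gen q .n + μ • (E.gen q .v - 1))) ∧
            (∀ p : ℤ, ρ (CZ.c k p ⊗ₜ E.gen q .nbar) =
              q ^ (2 * p) • (q ^ (-2 * s) • E.gen q .nbar + ν • (E.gen q .vinv - 1))) ∧
            -- the crossed product exists and is isomorphic to `E_q(2)` as an algebra
            ∃ (h : D.IsCrossedProductData ρ σ)
              (Θ : EntwiningData.CrossedProduct h ≃ₐ[k] E q),
              ∀ (x : X q) (c : CZ k),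
                Θ (EntwiningData.CrossedProduct.of h (ι x ⊗ₜ c)) = (ι x : E q) * Phi q s c := by
  have inv_zpow : ∀ c : k, (c * q ^ (2 * s))⁻¹ = c⁻¹ * q ^ (-2 * s) := fun c => by
    rw [mul_inv, ← zpow_neg, neg_mul]
  refine ⟨⟨_, ⟨(entwiningAction μ ν hq).toEntwining_compatibleAlg,
      hasGenValues_entwiningAction μ ν hq⟩, fun ψ h =>
      h.1.ext_of_hasGenValues (ActionData.toEntwining_compatibleAlg _) h.2
        (hasGenValues_entwiningAction μ ν hq)⟩,
    euclideanData μ ν hq s, euclideanData_hasGenValues, rfl, psiC_tmul s,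
    hyperboloidEquiv hq s hμ hν, ?_, ?_, Phi_e, Phi_isCovariant, phiUnit q s, rfl,
    rho μ ν hq s, sigma μ ν hq s, rfl, val_comp_sigma, sigma_tmul, rho_v, rho_vinv, rho_n,
    rho_nbar, isCrossedProductData, crossedProductEquiv μ ν hq s, fun x c =>
      crossedProductEquiv_of _ c⟩
  · rw [hyperboloidEquiv_apply, hyperboloidHom_z, inv_zpow]
  · rw [hyperboloidEquiv_apply, hyperboloidHom_zbar, inv_zpow]
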